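/- Let $k$ be an algebraically closed field and let $A$ be a finite dimensional $k$-algebra which is connected (not a direct product of two nonzero algebras), hereditary (every left ideal is projective) and of finite representation type (there are only finitely many isomorphism classes of indecomposable finitely generated left $A$-modules). For a finite dimensional $k$-algebra $\Gamma$ let $D^b(\Gamma)$ be the bounded derived category of finitely generated left $\Gamma$-modules. An object of an additive category is called basic if its indecomposable direct summands are pairwise non-isomorphic, and $\Gamma$ is called basic if its left regular module is basic. A tilting complex is an object $T$ of $D^b(A)$ such that $\operatorname{Hom}_{D^b(A)}(T,T[n])=0$ for all $n\neq 0$ and such that the smallest triangulated subcategory of $D^b(A)$ which contains $T$ and is closed under isomorphisms, shifts, direct summands and finite direct sums is the category of perfect complexes, that is, of the objects isomorphic in $D^b(A)$ to bounded complexes of finitely generated projective $A$-modules. Then: 1. Up to shift and isomorphism there are only finitely many basic tilting complexes in $D^b(A)$: there is a finite set $S$ of objects of $D^b(A)$ such that every basic tilting complex is isomorphic to $X[n]$ for some $X\in S$ and $n\in\mathbb{Z}$. 2. Up to isomorphism of $k$-algebras there are only finitely many basic finite dimensional $k$-algebras $\Gamma$ that are derived equivalent to $A$, i.e. for which there is a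 $k$-linear triangulated equivalence $D^b(A)\simeq D^b(\Gamma)$. -/

import Mathlib

open CategoryTheory CategoryTheory.Limits

universe u

noncomputable section

namespace DerivedFinite

/-- An object is basic if its indecomposable direct summands are pairwise non-isomorphic: no
direct sum decomposition of it has two isomorphic indecomposable summands. -/
def IsBasicObject {C : Type*} [Category* C] [HasZeroMorphisms C] [HasBinaryBiproducts C]
    (T : C) : Prop :=
  ∀ X Y Z : C, Indecomposable X → Indecomposable Y → Nonempty (T ≅ (X ⊞ Y) ⊞ Z) → IsEmpty (X ≅ Y)

section Rings

variable (A : Type u) [Ring A]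

/-- Every left ideal is a projective left module. -/
def IsHereditary : Prop := ∀ I : Submodule A A, Module.Projective A I

variable [IsNoetherianRing A]

/-- Up to isomorphism there are only finitely many indecomposable finitely generated left
modules. -/
def IsFiniteRepresentationType : Prop :=
  ∃ S : Set (FGModuleCat.{u} A), S.Finite ∧
    ∀ M : FGModuleCat.{u} A, Indecomposable M → ∃ N ∈ S, Nonempty (M ≅ N)

/-- The ring `A` is basic: the indecomposable summands of the left regular module are pairwise
non-isomorphic. -/
def IsBasicRing : Prop := IsBasicObject (FGModuleCat.of A A)

/-- The chosen model of the derived category of finitely generated left `A`-modules is the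
constructed localization of cochain complexes at the quasi-isomorphisms. -/
instance instHasDerivedCategory : HasDerivedCategory.{u + 1} (FGModuleCat.{u} A) :=
  HasDerivedCategory.standard _

/-- The bounded derived category of the category of finitely generated left `A`-modules: the full
triangulated subcategory of the derived category on the objects with bounded cohomology. -/
abbrev BoundedDerivedCategory : Type (u + 1) :=
  (DerivedCategory.TStructure.t (C := FGModuleCat.{u} A)).bounded.FullSubcategory

variable {A}

/-- The objects that are isomorphic in the derived category to a bounded complex of finitely
generated projective modules. -/
def IsPerfect : ObjectProperty (BoundedDerivedCategory A) := fun X ↦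
  ∃ (K : CochainComplex (FGModuleCat.{u} A) ℤ) (a b : ℤ), K.IsStrictlyGE a ∧ K.IsStrictlyLE b ∧
    (∀ i, Module.Projective A (K.X i)) ∧ Nonempty (X.obj ≅ DerivedCategory.Q.obj K)

/-- A tilting complex: it has no nonzero morphism to its nontrivial shifts, and the
smallest triangulated subcategory closed under isomorphisms, shifts, direct summands and finite
sums which contains it (`triangEnvelope`) is the category of perfect complexes. In particular, it
is itself perfect. -/
structure IsTiltingComplex (T : BoundedDerivedCategory A) : Prop where
  exceptional : ∀ n : ℤ, n ≠ 0 → ∀ f : T ⟶ T⟦n⟧, f = 0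
  generates : (ObjectProperty.singleton T).triangEnvelope = IsPerfect

end Rings

section Algebras

variable (k : Type u) [Field k]

/-- The algebra `A` is not a direct product of two nonzero algebras. -/
def IsConnectedAlgebra (A : Type u) [Ring A] [Algebra k A] : Prop :=
  ∀ (B C : Type u) [Ring B] [Ring C] [Algebra k B] [Algebra k C],
    Nonempty (A ≃ₐ[k] B × C) → Subsingleton B ∨ Subsingleton C

/-- `A` and `B` are derived equivalent as `k`-algebras: there is a `k`-linear triangulated
equivalence between their bounded derived categories. -/
def DerivedEquivalent (A B : Type u) [Ring A] [Algebra k A] [IsNoetherianRing A]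
    [Ring B] [Algebra k B] [IsNoetherianRing B] : Prop :=
  ∃ (F : BoundedDerivedCategory A ⥤ BoundedDerivedCategory B) (_ : F.CommShift ℤ),
    F.IsTriangulated ∧ F.Linear k ∧ F.IsEquivalence

end Algebras

end DerivedFinite

end

-- Write M[n] for a module M placed in degree zero and shifted by n. As `A` is hereditary, all Ext
-- groups of degree at least 2 vanish. Hence truncation triangles split, every object of the bounded
-- derived category is a finite direct sum of objects M[n], and Hom(M[p], N[q]) = 0 unless q - p is
-- 0 or 1 (`isHereditaryEmbedding_boundedSingle`). By finite representation type the M can be taken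
-- indecomposable in a finite set, of size s say.
--
-- Let T be basic and without nonzero morphisms to its nontrivial shifts. Each M occurs only once in
-- T: the identity of M would make two copies in different shifts a nonzero morphism from T to a
-- nontrivial shift of T (`nodup_of_isExceptional`). So T has at most s summands. If T is not a sum
-- of two nonzero mutually orthogonal objects, then the shifts that occur have no gap
-- (`exists_mem_snd_eq`): across a gap they differ by at least 2, so the two parts would be
-- orthogonal. After a global shift they all lie in [0, s], which leaves finitely many T
-- (`exists_finite`).
--
-- It remains to exclude orthogonal decompositions. For a tilting complex T = X₁ ⊕ X₂ with
-- orthogonal X₁ and X₂, objects of the thick subcategory generated by T are retracts of orthogonal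
-- sums Y₁ ⊕ Y₂ (`exists_retract_biprod_of_triangEnvelope`). This applies to the regular module; by
-- connectedness it is a retract of one Yᵢ, hence orthogonal to X₁ or X₂, which must then vanish.
--
-- If `B` is basic and derived equivalent to `A`, let T correspond to the regular `B`-module. Then T
-- is basic and exceptional, and End T is the opposite of `B`. A central idempotent of `B` acts on
-- the whole derived category; on the object corresponding to the regular `A`-module it is 0 or 1 by
-- connectedness, and therefore it is 0 or 1 everywhere. So T does not decompose orthogonally
-- either, and `B` is recovered from one of finitely many T.

universe w v

noncomputable section

namespace DerivedFinite

open ZeroObject Pretriangulated Triangulated DerivedCategory DerivedCategory.TStructure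

/-! ### Finite direct sums, shifts and transport along equivalences -/

section FiniteSums

variable {C : Type*} [Category* C] [Preadditive C] [HasZeroObject C] [HasBinaryBiproducts C]

/-- The direct sum of a list of objects. -/
def sumList (L : List C) : C := L.foldr (fun X Y ↦ X ⊞ Y) 0

@[simp] lemma sumList_nil : sumList ([] : List C) = 0 := rfl

@[simp] lemma sumList_cons (X : C) (L : List C) : sumList (X :: L) = (X ⊞ sumList L) := rfl

/-- Adding a zero object on the left does not change an object. -/
def zeroBiprodIso {Z : C} (hZ : IsZero Z) (X : C) : (Z ⊞ X) ≅ X where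
  hom := biprod.snd
  inv := biprod.inr
  hom_inv_id := by
    apply biprod.hom_ext'
    · exact hZ.eq_of_src _ _
    · simp

lemma nonempty_sumList_append (L₁ L₂ : List C) :
    Nonempty (sumList (L₁ ++ L₂) ≅ sumList L₁ ⊞ sumList L₂) := by
  induction L₁ with
  | nil => exact ⟨(zeroBiprodIso (isZero_zero C) _).symm⟩
  | cons X L ih =>
    obtain ⟨e⟩ := ih
    exact ⟨biprod.mapIso (Iso.refl X) e ≪≫ (biprod.associator _ _ _).symm⟩

lemma nonempty_sumList_of_perm {L₁ L₂ : List C} (h : L₁.Perm L₂) :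
    Nonempty (sumList L₁ ≅ sumList L₂) := by
  induction h with
  | nil => exact ⟨Iso.refl _⟩
  | cons X _ ih => exact ih.map fun e ↦ biprod.mapIso (Iso.refl X) e
  | swap X Y L =>
    exact ⟨(biprod.associator _ _ _).symm ≪≫
      biprod.mapIso (biprod.braiding Y X) (Iso.refl _) ≪≫ biprod.associator _ _ _⟩
  | trans _ _ h₁ h₂ => exact h₁.elim fun e₁ ↦ h₂.map fun e₂ ↦ e₁ ≪≫ e₂

lemma nonempty_sumList_map {ι : Type*} (L : List ι) (f g : ι → C)
    (h : ∀ i ∈ L, Nonempty (f i ≅ g i)) :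
    Nonempty (sumList (L.map f) ≅ sumList (L.map g)) := by
  induction L with
  | nil => exact ⟨Iso.refl _⟩
  | cons i L ih =>
    obtain ⟨e⟩ := h i (by simp)
    obtain ⟨e'⟩ := ih fun j hj ↦ h j (by simp [hj])
    exact ⟨biprod.mapIso e e'⟩

lemma nonempty_map_sumList {D : Type*} [Category* D] [Preadditive D] [HasZeroObject D]
    [HasBinaryBiproducts D] (F : C ⥤ D) [F.Additive] (L : List C) :
    Nonempty (F.obj (sumList L) ≅ sumList (L.map F.obj)) := by
  induction L with
  | nil => exact ⟨(F.map_isZero (isZero_zero C)).iso (isZero_zero D)⟩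
  | cons X L ih =>
    have := preservesBinaryBiproducts_of_preservesBiproducts F
    exact ih.map fun e ↦ F.mapBiprod _ _ ≪≫ biprod.mapIso (Iso.refl _) e

lemma prop_sumList (P : ObjectProperty C) (h₀ : P 0) (h₁ : ∀ X Y, P X → P Y → P (X ⊞ Y))
    (L : List C) (hL : ∀ X ∈ L, P X) : P (sumList L) := by
  induction L with
  | nil => exact h₀
  | cons X L ih => exact h₁ _ _ (hL X (by simp)) (ih fun Y hY ↦ hL Y (by simp [hY]))

/-- A member of a list is a retract of the sum of the list. -/
lemma nonempty_retract_sumList {X : C} {L : List C} (h : X ∈ L) :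
    Nonempty (Retract X (sumList L)) := by
  induction L with
  | nil => simp at h
  | cons Y L ih =>
    rcases List.mem_cons.1 h with rfl | h
    · exact ⟨⟨(biprod.inl : X ⟶ X ⊞ sumList L), biprod.fst, biprod.inl_fst⟩⟩
    · obtain ⟨r⟩ := ih h
      exact ⟨(r.trans ⟨biprod.inr, biprod.snd, biprod.inr_snd⟩ : Retract X (Y ⊞ sumList L))⟩

lemma nonempty_sumList_flatten {ι : Type*} (L : List ι) (f : ι → List C) :
    Nonempty (sumList (L.flatMap f) ≅ sumList (L.map fun i ↦ sumList (f i))) := by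
  induction L with
  | nil => exact ⟨Iso.refl _⟩
  | cons i L ih =>
    obtain ⟨e⟩ := ih
    obtain ⟨e'⟩ := nonempty_sumList_append (f i) (L.flatMap f)
    exact ⟨e' ≪≫ biprod.mapIso (Iso.refl _) e⟩

lemma eq_zero_of_sumList {X : C} {L : List C} (h : ∀ Y ∈ L, ∀ f : Y ⟶ X, f = 0)
    (f : sumList L ⟶ X) : f = 0 :=
  prop_sumList (fun Y ↦ ∀ f : Y ⟶ X, f = 0) (fun _ ↦ (isZero_zero C).eq_of_src _ _)
    (fun _ _ h₁ h₂ f ↦ biprod.hom_ext' _ _ (by rw [h₁ (biprod.inl ≫ f), comp_zero])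
      (by rw [h₂ (biprod.inr ≫ f), comp_zero])) L h f

end FiniteSums

section Shift

variable {C : Type*} [Category* C] [Preadditive C] [HasShift C ℤ]
  [∀ n : ℤ, (shiftFunctor C n).Additive]

omit [∀ n : ℤ, (shiftFunctor C n).Additive] in
lemma eq_zero_of_iso_shift {X X' Y Y' : C} {n : ℤ} (e : X ≅ X') (e' : Y ≅ Y')
    (h : ∀ f : X' ⟶ Y'⟦n⟧, f = 0) (f : X ⟶ Y⟦n⟧) : f = 0 := by
  rw [← cancel_epi e.inv, ← cancel_mono (e'.hom⟦n⟧'), h ((e.inv ≫ f) ≫ e'.hom⟦n⟧')]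
  simp

lemma eq_zero_of_shift {X Y : C} {a b c : ℤ} (hc : a + c = b)
    (h : ∀ f : X ⟶ Y⟦c⟧, f = 0) (f : X⟦a⟧ ⟶ Y⟦b⟧) : f = 0 := by
  let e := (shiftFunctorAdd' C c a b (by lia)).app Y
  obtain ⟨g, hg⟩ := (shiftFunctor C a).map_surjective (f ≫ e.hom)
  rw [← cancel_mono e.hom, ← hg, h g]
  simp

variable [HasBinaryBiproducts C]

lemma eq_zero_to_biprod_shift {X Y₁ Y₂ : C} {n : ℤ} (h₁ : ∀ f : X ⟶ Y₁⟦n⟧, f = 0)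
    (h₂ : ∀ f : X ⟶ Y₂⟦n⟧, f = 0) (f : X ⟶ (Y₁ ⊞ Y₂)⟦n⟧) : f = 0 := by
  have h : f ≫ (shiftFunctor C n).map (biprod.fst ≫ biprod.inl + biprod.snd ≫ biprod.inr) = f := by
    simp
  rw [← h, Functor.map_add, Functor.map_comp, Functor.map_comp, Preadditive.comp_add,
    ← Category.assoc, ← Category.assoc, h₁ (f ≫ _), h₂ (f ≫ _)]
  simp

variable [HasZeroObject C]

lemma eq_zero_to_sumList_shift {X : C} {L : List C} {n : ℤ}
    (h : ∀ Y ∈ L, ∀ f : X ⟶ Y⟦n⟧, f = 0) (f : X ⟶ (sumList L)⟦n⟧) : f = 0 :=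
  prop_sumList (fun Y ↦ ∀ f : X ⟶ Y⟦n⟧, f = 0)
    (fun _ ↦ ((shiftFunctor C n).map_isZero (isZero_zero C)).eq_of_tgt _ _)
    (fun _ _ h₁ h₂ f ↦ eq_zero_to_biprod_shift h₁ h₂ f) L h f

end Shift

section Transport

variable {C D : Type*} [Category* C] [Category* D] [Preadditive C] [Preadditive D]
  [HasBinaryBiproducts C] [HasBinaryBiproducts D]

lemma Indecomposable.of_iso {X Y : C} (e : X ≅ Y) (h : Indecomposable X) : Indecomposable Y :=
  ⟨fun hY ↦ h.1 (hY.of_iso e), fun U V i ↦ h.2 U V (e ≪≫ i)⟩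

lemma indecomposable_map_iff (F : C ⥤ D) [F.Additive] [F.IsEquivalence] (X : C) :
    Indecomposable (F.obj X) ↔ Indecomposable X := by
  have := preservesBinaryBiproducts_of_preservesBiproducts F
  have hz (Z : C) : IsZero (F.obj Z) ↔ IsZero Z := by
    simp only [IsZero.iff_id_eq_zero]
    rw [← F.map_id, F.map_eq_zero_iff]
  refine ⟨fun h ↦ ⟨fun hX ↦ h.1 ((hz X).2 hX), fun U V i ↦ ?_⟩,
    fun h ↦ ⟨fun hX ↦ h.1 ((hz X).1 hX), fun U V i ↦ ?_⟩⟩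
  · rw [← hz, ← hz]
    exact h.2 _ _ (F.mapIso i ≪≫ F.mapBiprod _ _)
  · have := h.2 (F.objPreimage U) (F.objPreimage V) (F.preimageIso (i ≪≫
      biprod.mapIso (F.objObjPreimageIso U).symm (F.objObjPreimageIso V).symm ≪≫
        (F.mapBiprod _ _).symm))
    rw [← hz, ← hz] at this
    exact this.imp (fun h ↦ h.of_iso (F.objObjPreimageIso U).symm)
      (fun h ↦ h.of_iso (F.objObjPreimageIso V).symm)

lemma IsBasicObject.of_map (F : C ⥤ D) [F.Additive] [F.IsEquivalence] {T : C}
    (h : IsBasicObject (F.obj T)) : IsBasicObject T := by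
  have := preservesBinaryBiproducts_of_preservesBiproducts F
  rintro X Y Z hX hY ⟨e⟩
  have := h (F.obj X) (F.obj Y) (F.obj Z) ((indecomposable_map_iff F X).2 hX)
    ((indecomposable_map_iff F Y).2 hY)
    ⟨F.mapIso e ≪≫ F.mapBiprod _ _ ≪≫ biprod.mapIso (F.mapBiprod _ _) (Iso.refl _)⟩
  exact ⟨fun i ↦ this.false (F.mapIso i)⟩

lemma IsBasicObject.of_iso {X Y : C} (e : X ≅ Y) (h : IsBasicObject X) : IsBasicObject Y :=
  fun U V Z hU hV hi ↦ h U V Z hU hV (hi.map fun i ↦ e ≪≫ i)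

end Transport

/-! ### Basic exceptional objects over a hereditary category -/

section Abstract

variable {C T : Type*} [Category* C] [Category* T] [Preadditive C] [Preadditive T]
  [HasZeroObject C] [HasZeroObject T] [HasBinaryBiproducts C] [HasBinaryBiproducts T]
  [HasShift T ℤ] [∀ n : ℤ, (shiftFunctor T n).Additive]

/-- An object without nonzero morphisms to its nontrivial shifts. -/
def IsExceptional (X : T) : Prop := ∀ n : ℤ, n ≠ 0 → ∀ f : X ⟶ X⟦n⟧, f = 0

/-- An object which has no decomposition into two nonzero objects such that there are no nonzero
morphisms between them and their shifts. -/
def IsOrthogonallyIndecomposable (X : T) : Prop :=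
  ∀ X₁ X₂ : T, Nonempty (X ≅ X₁ ⊞ X₂) → (∀ (n : ℤ) (f : X₁ ⟶ X₂⟦n⟧), f = 0) →
    (∀ (n : ℤ) (f : X₂ ⟶ X₁⟦n⟧), f = 0) → IsZero X₁ ∨ IsZero X₂

/-- The properties of the embedding of a hereditary abelian category in its bounded derived
category. -/
structure IsHereditaryEmbedding (E : C ⥤ T) : Prop where
  eq_zero : ∀ (M N : C) (n : ℤ), n ≠ 0 → n ≠ 1 → ∀ f : E.obj M ⟶ (E.obj N)⟦n⟧, f = 0
  exists_sum : ∀ X : T, ∃ L : List (C × ℤ),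
    Nonempty (X ≅ sumList (L.map fun p ↦ (E.obj p.1)⟦p.2⟧))
  exists_of_iso : ∀ (M : C) (X Y : T), Nonempty (E.obj M ≅ X ⊞ Y) →
    ∃ N : C, Nonempty (X ≅ E.obj N)

omit [HasZeroObject T] [HasBinaryBiproducts T] [∀ n : ℤ, (shiftFunctor T n).Additive] in
lemma IsExceptional.eq_zero_of_retract {X Y Z : T} (h : IsExceptional X) (r : Retract Y X)
    (s : Retract Z X) {n : ℤ} (hn : n ≠ 0) (f : Y ⟶ Z⟦n⟧) : f = 0 := by
  have h₁ : r.r ≫ f ≫ s.i⟦n⟧' = 0 := h n hn _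
  have h₂ : r.i ≫ (r.r ≫ f ≫ s.i⟦n⟧') ≫ s.r⟦n⟧' = f := by
    simp only [Category.assoc, ← Functor.map_comp, s.retract, r.retract_assoc]
    simp
  rw [← h₂, h₁]
  simp

/-- A gap-free set with least element m that reaches beyond m + s contains the s + 1 integers from m
to m + s, too many for its cardinality. -/
lemma exists_forall_mem_Icc (K : Finset ℤ) (s : ℕ) (hs : K.card ≤ s)
    (h : ∀ t, (∃ n ∈ K, n ≤ t) → (∃ n ∈ K, t < n) → t ∈ K) :
    ∃ c : ℤ, ∀ n ∈ K, n - c ∈ Set.Icc (0 : ℤ) s := by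
  rcases K.eq_empty_or_nonempty with rfl | hK
  · exact ⟨0, by simp⟩
  refine ⟨K.min' hK, fun n hn ↦ ⟨by linarith [K.min'_le n hn], ?_⟩⟩
  by_contra! hlt
  have hsub : Finset.Icc (K.min' hK) (K.min' hK + s) ⊆ K := fun t ht ↦ by
    rw [Finset.mem_Icc] at ht
    exact h t ⟨_, K.min'_mem hK, ht.1⟩ ⟨n, hn, by linarith⟩
  have := Finset.card_le_card hsub
  simp at this
  lia

variable (E : C ⥤ T) [E.Additive] [E.Full] [E.Faithful]

/-- A shift of an object in the image of an embedding. -/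
def shiftObj (p : C × ℤ) : T := (E.obj p.1)⟦p.2⟧

variable {E}

namespace IsHereditaryEmbedding

variable (hE : IsHereditaryEmbedding E)
include hE

omit [Preadditive C] [HasZeroObject C] [HasBinaryBiproducts C] [E.Additive] [E.Full]
  [E.Faithful] in
lemma eq_zero_shiftObj {p q : C × ℤ} {n : ℤ} (h₀ : q.2 + n - p.2 ≠ 0) (h₁ : q.2 + n - p.2 ≠ 1)
    (f : shiftObj E p ⟶ (shiftObj E q)⟦n⟧) : f = 0 := by
  let e : (E.obj q.1)⟦q.2 + n⟧ ≅ (shiftObj E q)⟦n⟧ :=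
    (shiftFunctorAdd' T q.2 n (q.2 + n) rfl).app (E.obj q.1)
  rw [← cancel_mono e.inv, zero_comp]
  exact eq_zero_of_shift (c := q.2 + n - p.2) (by lia) (hE.eq_zero _ _ _ h₀ h₁) _

-- Summands of an object in the image of `E` come from `C`, so a decomposition lifts along the fully
-- faithful `E`.
omit [HasZeroObject C] [∀ n : ℤ, (shiftFunctor T n).Additive] in
lemma indecomposable_obj {M : C} (hM : Indecomposable M) : Indecomposable (E.obj M) := by
  have hz (N : C) (hN : IsZero N) : IsZero (E.obj N) := E.map_isZero hN
  refine ⟨fun h ↦ hM.1 ?_, fun X Y e ↦ ?_⟩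
  · rw [IsZero.iff_id_eq_zero] at h ⊢
    exact E.map_injective (by rw [E.map_id, h, E.map_zero])
  · have := preservesBinaryBiproducts_of_preservesBiproducts E
    obtain ⟨M₁, ⟨e₁⟩⟩ := hE.exists_of_iso M X Y ⟨e⟩
    obtain ⟨M₂, ⟨e₂⟩⟩ := hE.exists_of_iso M Y X ⟨e ≪≫ biprod.braiding X Y⟩
    have := hM.2 M₁ M₂ (E.preimageIso (e ≪≫ biprod.mapIso e₁ e₂ ≪≫ (E.mapBiprod _ _).symm))
    exact this.imp (fun h ↦ (hz _ h).of_iso e₁) (fun h ↦ (hz _ h).of_iso e₂)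

omit [HasZeroObject C] in
lemma indecomposable_shiftObj {p : C × ℤ} (hp : Indecomposable p.1) :
    Indecomposable (shiftObj E p) :=
  (indecomposable_map_iff (shiftFunctor T p.2) _).2 (hE.indecomposable_obj hp)

omit [E.Full] [E.Faithful] in
lemma exists_sum_indecomposable {S : Set C}
    (hS : ∀ M : C, ∃ L : List C, (∀ N ∈ L, N ∈ S ∧ Indecomposable N) ∧ Nonempty (M ≅ sumList L))
    (X : T) : ∃ L : List (C × ℤ), (∀ p ∈ L, p.1 ∈ S ∧ Indecomposable p.1) ∧
      Nonempty (X ≅ sumList (L.map (shiftObj E))) := by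
  choose d hd e using hS
  obtain ⟨L, ⟨i⟩⟩ := hE.exists_sum X
  refine ⟨L.flatMap fun p ↦ (d p.1).map fun M ↦ (M, p.2), ?_, ?_⟩
  · intro p hp
    simp only [List.mem_flatMap, List.mem_map] at hp
    obtain ⟨q, -, M, hM, rfl⟩ := hp
    exact hd q.1 M hM
  · rw [List.map_flatMap]
    obtain ⟨j⟩ := nonempty_sumList_flatten L
      fun p ↦ ((d p.1).map fun M ↦ (M, p.2)).map (shiftObj E)
    have h (p : C × ℤ) : Nonempty ((E.obj p.1)⟦p.2⟧ ≅
        sumList (((d p.1).map fun M ↦ (M, p.2)).map (shiftObj E))) := by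
      obtain ⟨e⟩ := e p.1
      obtain ⟨e'⟩ := nonempty_map_sumList (E ⋙ shiftFunctor T p.2) (d p.1)
      rw [List.map_map]
      exact ⟨(E ⋙ shiftFunctor T p.2).mapIso e ≪≫ e'⟩
    obtain ⟨l⟩ := nonempty_sumList_map L _ _ fun p _ ↦ h p
    exact ⟨i ≪≫ l ≪≫ j.symm⟩

omit [HasZeroObject C] in
lemma nodup_of_isExceptional {X : T} (hX : IsExceptional X) (hb : IsBasicObject X)
    {L : List (C × ℤ)} (hL : ∀ p ∈ L, Indecomposable p.1)
    (e : X ≅ sumList (L.map (shiftObj E))) : (L.map Prod.fst).Nodup := by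
  by_contra h
  rw [← List.exists_duplicate_iff_not_nodup] at h
  obtain ⟨M, hM⟩ := h
  rw [List.duplicate_iff_sublist, List.sublist_map_iff] at hM
  obtain ⟨l, hl, hl'⟩ := hM
  obtain ⟨p, q, rfl⟩ : ∃ p q, l = [p, q] :=
    List.length_eq_two.1 (by simpa using (congrArg List.length hl').symm)
  simp only [List.map_cons, List.map_nil, List.cons.injEq, and_true] at hl'
  obtain ⟨hp, hq⟩ := hl'
  obtain ⟨L', hL'⟩ := hl.exists_perm_append
  obtain ⟨i⟩ := nonempty_sumList_of_perm (hL'.map (shiftObj E))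
  have hpL : p ∈ L := hl.subset (by simp)
  have hqL : q ∈ L := hl.subset (by simp)
  -- Equal shifts give a repeated indecomposable summand, against basicness. Distinct shifts give an
  -- isomorphism M[p] ≅ M[q][p - q], which exceptionality forces to be zero.
  by_cases hpq : p.2 = q.2
  · obtain rfl : p = q := Prod.ext (hp.symm.trans hq) hpq
    exact (hb _ _ _ (hE.indecomposable_shiftObj (hL p hpL))
      (hE.indecomposable_shiftObj (hL p hpL))
      ⟨e ≪≫ i ≪≫ (biprod.associator _ _ (sumList (L'.map (shiftObj E)))).symm⟩).false (Iso.refl _)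
  · obtain ⟨r⟩ := nonempty_retract_sumList (List.mem_map_of_mem (f := shiftObj E) hpL)
    obtain ⟨s⟩ := nonempty_retract_sumList (List.mem_map_of_mem (f := shiftObj E) hqL)
    have r' := r.trans (Retract.ofIso e.symm)
    have s' := s.trans (Retract.ofIso e.symm)
    have h := hX.eq_zero_of_retract r' s' (n := p.2 - q.2) (by lia)
    let a : shiftObj E p ≅ (shiftObj E q)⟦p.2 - q.2⟧ :=
      (shiftFunctorAdd' T q.2 (p.2 - q.2) p.2 (by lia)).app (E.obj p.1) ≪≫
        eqToIso (by rw [← hp, hq]; rfl)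
    refine (hE.indecomposable_shiftObj (hL p hpL)).1 ?_
    rw [IsZero.iff_id_eq_zero, ← cancel_mono a.hom, zero_comp]
    exact h _

omit [HasZeroObject C] in
lemma exists_mem_snd_eq {X : T} (hX : IsExceptional X) (hc : IsOrthogonallyIndecomposable X)
    {L : List (C × ℤ)} (hL : ∀ p ∈ L, Indecomposable p.1)
    (e : X ≅ sumList (L.map (shiftObj E))) {t : ℤ} {p q : C × ℤ} (hpL : p ∈ L) (hqL : q ∈ L)
    (hp : p.2 ≤ t) (hq : t < q.2) : ∃ r ∈ L, r.2 = t := by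
  by_contra! ht
  -- Cut the sum at the missing shift t. Shifts on the two sides differ by at least 2, so
  -- degree-zero morphisms vanish in both directions; the other degrees vanish because both parts
  -- are retracts of the exceptional `X`.
  let L₁ := L.filter fun r ↦ r.2 ≤ t
  let L₂ := L.filter fun r ↦ ¬ r.2 ≤ t
  have hL₁ : ∀ r ∈ L₁, r.2 < t := fun r hr ↦ by
    simp only [L₁, List.mem_filter, decide_eq_true_eq] at hr
    exact lt_of_le_of_ne hr.2 (ht r hr.1)
  have hL₂ : ∀ r ∈ L₂, t < r.2 := fun r hr ↦ by
    simpa [L₂] using (List.mem_filter.1 hr).2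
  have hperm : (L₁ ++ L₂).Perm L := by
    simpa only [L₁, L₂, decide_not] using
      List.filter_append_perm (fun r : C × ℤ ↦ decide (r.2 ≤ t)) L
  obtain ⟨i⟩ := nonempty_sumList_of_perm (hperm.map (shiftObj E))
  rw [List.map_append] at i
  obtain ⟨j⟩ := nonempty_sumList_append (L₁.map (shiftObj E)) (L₂.map (shiftObj E))
  let a := e ≪≫ i.symm ≪≫ j
  let r₁ : Retract (sumList (L₁.map (shiftObj E))) X :=
    Retract.trans ⟨biprod.inl, biprod.fst, biprod.inl_fst⟩ (Retract.ofIso a.symm)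
  let r₂ : Retract (sumList (L₂.map (shiftObj E))) X :=
    Retract.trans ⟨biprod.inr, biprod.snd, biprod.inr_snd⟩ (Retract.ofIso a.symm)
  have key (K K' : List (C × ℤ)) (hK : ∀ r ∈ K, ∀ r' ∈ K', r'.2 - r.2 ≠ 0 ∧ r'.2 - r.2 ≠ 1)
      (f : sumList (K.map (shiftObj E)) ⟶ (sumList (K'.map (shiftObj E)))⟦(0 : ℤ)⟧) : f = 0 := by
    refine eq_zero_of_sumList (fun Y hY f ↦ eq_zero_to_sumList_shift (fun Z hZ f ↦ ?_) f) f
    obtain ⟨r, hr, rfl⟩ := List.mem_map.1 hY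
    obtain ⟨r', hr', rfl⟩ := List.mem_map.1 hZ
    exact hE.eq_zero_shiftObj (by simpa using (hK r hr r' hr').1)
      (by simpa using (hK r hr r' hr').2) f
  have hz (K : List (C × ℤ)) (hK : IsZero (sumList (K.map (shiftObj E)))) (r : C × ℤ)
      (hrK : r ∈ K) (hrL : r ∈ L) : False := by
    obtain ⟨s⟩ := nonempty_retract_sumList (List.mem_map_of_mem (f := shiftObj E) hrK)
    refine (hE.indecomposable_shiftObj (hL r hrL)).1 ?_
    rw [IsZero.iff_id_eq_zero, ← s.retract, hK.eq_of_tgt s.i 0, zero_comp]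
  have h₁₂ (n : ℤ) (f : sumList (L₁.map (shiftObj E)) ⟶ (sumList (L₂.map (shiftObj E)))⟦n⟧) :
      f = 0 := by
    by_cases hn : n = 0
    · subst hn
      refine key _ _ (fun r hr r' hr' ↦ ?_) f
      have h₁ := hL₁ r hr
      have h₂ := hL₂ r' hr'
      lia
    · exact hX.eq_zero_of_retract r₁ r₂ hn f
  have h₂₁ (n : ℤ) (f : sumList (L₂.map (shiftObj E)) ⟶ (sumList (L₁.map (shiftObj E)))⟦n⟧) :
      f = 0 := by
    by_cases hn : n = 0
    · subst hn
      refine key _ _ (fun r hr r' hr' ↦ ?_) f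
      have h₁ := hL₁ r' hr'
      have h₂ := hL₂ r hr
      lia
    · exact hX.eq_zero_of_retract r₂ r₁ hn f
  rcases hc _ _ ⟨a⟩ h₁₂ h₂₁ with h | h
  · exact hz _ h p (by simp [L₁, hpL, hp]) hpL
  · exact hz _ h q (by simp [L₂, hqL, hq]) hqL

/-- If there are only finitely many indecomposable objects in a hereditary category, then up to
shift there are only finitely many basic exceptional objects that do not decompose orthogonally. -/
theorem exists_finite {S : Set C} (hfin : S.Finite)
    (hS : ∀ M : C, ∃ L : List C, (∀ N ∈ L, N ∈ S ∧ Indecomposable N) ∧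
      Nonempty (M ≅ sumList L)) :
    ∃ R : Set T, R.Finite ∧ ∀ X : T, IsExceptional X → IsBasicObject X →
      IsOrthogonallyIndecomposable X → ∃ Y ∈ R, ∃ n : ℤ, Nonempty (X ≅ Y⟦n⟧) := by
  classical
  -- The same s bounds the number of summands and, as the shifts have no gap, their spread; so lists
  -- of length at most s with entries from the finite set `P` suffice.
  let s := hfin.toFinset.card
  let P : Set (C × ℤ) := S ×ˢ Set.Icc (0 : ℤ) s
  have : Finite P := (hfin.prod (Set.finite_Icc _ _)).to_subtype
  refine ⟨(fun L : List P ↦ sumList (L.map fun p ↦ shiftObj E p.1)) '' {L | L.length ≤ s},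
    (List.finite_length_le P s).image _, fun X hX hb hc ↦ ?_⟩
  obtain ⟨L, hL, ⟨e⟩⟩ := hE.exists_sum_indecomposable hS X
  have hLi : ∀ p ∈ L, Indecomposable p.1 := fun p hp ↦ (hL p hp).2
  have hlen : L.length ≤ s := by
    rw [← List.length_map (as := L) Prod.fst,
      ← List.toFinset_card_of_nodup (hE.nodup_of_isExceptional hX hb hLi e)]
    refine Finset.card_le_card fun M hM ↦ ?_
    simp only [List.mem_toFinset, List.mem_map] at hM
    obtain ⟨p, hp, rfl⟩ := hM
    simpa using (hL p hp).1
  obtain ⟨c, hc⟩ := exists_forall_mem_Icc (L.map Prod.snd).toFinset s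
    ((List.toFinset_card_le _).trans (by simpa using hlen)) (by
      simp only [List.mem_toFinset, List.mem_map]
      rintro t ⟨_, ⟨p, hp, rfl⟩, hpt⟩ ⟨_, ⟨q, hq, rfl⟩, hqt⟩
      exact hE.exists_mem_snd_eq hX hc hLi e hp hq hpt hqt)
  let K : List P := L.attach.map fun p ↦ ⟨(p.1.1, p.1.2 - c), (hL p.1 p.2).1,
    hc _ (by simpa using ⟨_, p.2⟩)⟩
  refine ⟨_, ⟨K, by simpa [K] using hlen, rfl⟩, c, ?_⟩
  have hK : (K.map fun p ↦ shiftObj E p.1) = L.map fun p ↦ shiftObj E (p.1, p.2 - c) := by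
    simp only [K, List.map_map]
    exact List.attach_map_val (f := fun p : C × ℤ ↦ shiftObj E (p.1, p.2 - c))
  obtain ⟨i⟩ := nonempty_map_sumList (shiftFunctor T c) (K.map fun p ↦ shiftObj E p.1)
  rw [hK, List.map_map] at i
  obtain ⟨j⟩ := nonempty_sumList_map L (shiftObj E)
    ((shiftFunctor T c).obj ∘ fun p ↦ shiftObj E (p.1, p.2 - c))
    fun p _ ↦ ⟨(shiftFunctorAdd' T (p.2 - c) c p.2 (by lia)).app (E.obj p.1)⟩
  dsimp only
  rw [hK]
  exact ⟨e ≪≫ j ≪≫ i.symm⟩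

end IsHereditaryEmbedding

end Abstract

/-! ### An abelian category inside its bounded derived category -/

section BoundedSingle

variable (C : Type u) [Category.{v} C] [Abelian C] [HasDerivedCategory.{w} C]

/-- The embedding of an abelian category in its bounded derived category, in degree zero. -/
def boundedSingle : C ⥤ Bounded C :=
  (t (C := C)).bounded.lift (singleFunctor C 0) fun _ ↦
    ⟨⟨0, inferInstance⟩, ⟨0, inferInstance⟩⟩

instance : (boundedSingle C).Additive where
  map_add {X Y f g} := by
    ext
    exact (singleFunctor C 0).map_add

instance : (boundedSingle C).Full where
  map_surjective f := by
    obtain ⟨g, hg⟩ := (singleFunctor C 0).map_surjective f.hom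
    exact ⟨g, by ext; exact hg⟩

instance : (boundedSingle C).Faithful where
  map_injective h := (singleFunctor C 0).map_injective (congrArg (·.hom) h)

instance (R : Type*) [Ring R] [Linear R C] : (boundedSingle C).Linear R where
  map_smul f r := by
    ext
    exact (singleFunctor C 0).map_smul r f

variable {C}

/-- The inclusion of the bounded derived category maps shifts of modules to shifts of modules. -/
def ιShiftObjIso (p : C × ℤ) :
    Bounded.ι.obj (shiftObj (boundedSingle C) p) ≅ ((singleFunctor C 0).obj p.1)⟦p.2⟧ :=
  (Bounded.ι.commShiftIso p.2).app _

lemma isGE_of_retract {X Y : DerivedCategory C} (r : Retract X Y) (n : ℤ) (h : Y.IsGE n) :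
    X.IsGE n := by
  rw [isGE_iff] at h ⊢
  intro i hi
  have := r.map (homologyFunctor C i)
  rw [IsZero.iff_id_eq_zero, ← this.retract, (h i hi).eq_of_tgt this.i 0, zero_comp]

lemma isLE_of_retract {X Y : DerivedCategory C} (r : Retract X Y) (n : ℤ) (h : Y.IsLE n) :
    X.IsLE n := by
  rw [isLE_iff] at h ⊢
  intro i hi
  have := r.map (homologyFunctor C i)
  rw [IsZero.iff_id_eq_zero, ← this.retract, (h i hi).eq_of_tgt this.i 0, zero_comp]

/-- The essential image of an abelian category in its bounded derived category is closed under
retracts. -/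
lemma exists_iso_of_retract {M : C} {X : Bounded C} (r : Retract X ((boundedSingle C).obj M)) :
    ∃ N : C, Nonempty (X ≅ (boundedSingle C).obj N) := by
  have r' : Retract X.obj ((singleFunctor C 0).obj M) := r.map Bounded.ι
  have := isGE_of_retract r' 0 inferInstance
  have := isLE_of_retract r' 0 inferInstance
  obtain ⟨N, ⟨e⟩⟩ := exists_iso_singleFunctor_obj_of_isGE_of_isLE X.obj 0
  exact ⟨N, ⟨ObjectProperty.isoMk _ e⟩⟩

/-- Negative shifts are excluded by the t-structure; for n ≥ d the morphisms form an Ext group that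
vanishes by the bound on the projective dimension. -/
lemma single_hom_shift_eq_zero (M N : C) (d : ℕ) [HasProjectiveDimensionLT M d] (n : ℤ)
    (hn : n < 0 ∨ d ≤ n) (f : (singleFunctor C 0).obj M ⟶ ((singleFunctor C 0).obj N)⟦n⟧) :
    f = 0 := by
  by_cases hn' : n < 0
  · exact t.zero_of_isLE_of_isGE f 0 (-n) (by lia) inferInstance
      (t.isGE_shift _ 0 n (-n))
  · obtain ⟨m, rfl⟩ := Int.eq_ofNat_of_zero_le (not_lt.1 hn')
    have := HasExt.standard C
    have := HasProjectiveDimensionLT.subsingleton M d m (by lia) N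
    exact (Abelian.Ext.homEquiv (C := C) (X := M) (Y := N) (n := m)).symm.injective
      (Subsingleton.elim _ _)

lemma boundedSingle_hom_shift_eq_zero (M N : C) (d : ℕ) [HasProjectiveDimensionLT M d] (n : ℤ)
    (hn : n < 0 ∨ d ≤ n) (f : (boundedSingle C).obj M ⟶ ((boundedSingle C).obj N)⟦n⟧) :
    f = 0 := by
  apply Bounded.ι.map_injective
  rw [← cancel_mono ((Bounded.ι.commShiftIso n).hom.app _), Functor.map_zero, zero_comp]
  exact single_hom_shift_eq_zero M N d n hn _

/-- In global dimension at most one, every bounded complex is the direct sum of its shifted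
cohomology objects. -/
lemma exists_iso_sumList (h : ∀ M : C, HasProjectiveDimensionLT M 2) (a : ℤ) (d : ℕ)
    (X : DerivedCategory C) (hX : X.IsGE a) (hX' : X.IsLE (a + d - 1)) :
    ∃ L : List (C × ℤ), (∀ p ∈ L, -p.2 < a + d) ∧
      Nonempty (X ≅ sumList (L.map fun p ↦ ((singleFunctor C 0).obj p.1)⟦p.2⟧)) := by
  induction d generalizing X with
  | zero =>
    have : IsZero X := t.isZero X (a + (0 : ℕ) - 1) a (by simp)
    exact ⟨[], by simp, ⟨this.iso (isZero_zero _)⟩⟩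
  | succ d ih =>
    have hXd : X.IsLE (a + d) := by
      convert hX' using 1
      push_cast
      ring
    -- Split off the top cohomology, in degree a + d; the induction hypothesis decomposes the
    -- truncation below it.
    obtain ⟨L, hL, ⟨e⟩⟩ := ih ((t.truncLT (a + d)).obj X) inferInstance inferInstance
    obtain ⟨Y, ⟨e'⟩⟩ := exists_iso_singleFunctor_obj_of_isGE_of_isLE
      ((t.truncGE (a + d)).obj X) (a + d)
    let e'' : (t.truncGE (a + d)).obj X ≅ ((singleFunctor C 0).obj Y)⟦-(a + d)⟧ := e' ≪≫
      (((singleFunctors C).shiftIso (-(a + d)) (a + d) 0 (by simp)).app Y).symm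
    have hT := t.triangleLTGE_distinguished (a + d) X
    -- The components of the connecting morphism have degree p.2 + 1 + (a + d), which is at least 2
    -- because -p.2 < a + d. The bound on the shifts is carried through the induction for this
    -- purpose.
    have h₀ : ((t.triangleLTGE (a + d)).obj X).mor₃ = 0 := by
      have hz (f : ((singleFunctor C 0).obj Y)⟦-(a + d)⟧ ⟶
          (sumList (L.map fun p ↦ ((singleFunctor C 0).obj p.1)⟦p.2⟧))⟦(1 : ℤ)⟧) : f = 0 := by
        refine eq_zero_to_sumList_shift (fun Z hZ f ↦ ?_) f
        obtain ⟨p, hp, rfl⟩ := List.mem_map.1 hZ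
        have hp' := hL p hp
        rw [← cancel_mono ((shiftFunctorAdd' _ p.2 1 (p.2 + 1) rfl).inv.app _), zero_comp]
        exact eq_zero_of_shift (c := p.2 + 1 + (a + d)) (by lia)
          (have := h Y; single_hom_shift_eq_zero _ _ 2 _ (by lia)) _
      exact eq_zero_of_iso_shift e'' e hz _
    obtain ⟨i, -⟩ := exists_iso_binaryBiproduct_of_distTriang _ hT h₀
    refine ⟨(Y, -(a + d)) :: L, fun p hp ↦ ?_,
      ⟨i ≪≫ biprod.mapIso e e'' ≪≫ biprod.braiding _ _⟩⟩
    rcases List.mem_cons.1 hp with rfl | hp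
    · push_cast
      lia
    · have := hL p hp
      push_cast
      lia

theorem isHereditaryEmbedding_boundedSingle (h : ∀ M : C, HasProjectiveDimensionLT M 2) :
    IsHereditaryEmbedding (boundedSingle C) where
  eq_zero M N n h₀ h₁ f :=
    have := h M
    boundedSingle_hom_shift_eq_zero M N 2 n (by lia) f
  exists_sum X := by
    obtain ⟨⟨a, ha⟩, ⟨b, hb⟩⟩ := X.property
    -- If b < a the width is 0, and the bound a - 1 is still at least b.
    have : X.obj.IsLE (a + (b - a + 1).toNat - 1) := t.isLE_of_le X.obj b _ (by lia)
    obtain ⟨L, -, ⟨e⟩⟩ := exists_iso_sumList h a (b - a + 1).toNat X.obj ha this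
    obtain ⟨i⟩ := nonempty_map_sumList (Bounded.ι (C := C)) (L.map (shiftObj (boundedSingle C)))
    rw [List.map_map] at i
    obtain ⟨j⟩ := nonempty_sumList_map L (Bounded.ι.obj ∘ shiftObj (boundedSingle C)) _
      fun p _ ↦ ⟨ιShiftObjIso p⟩
    exact ⟨L, ⟨ObjectProperty.isoMk _ (e ≪≫ j.symm ≪≫ i.symm)⟩⟩
  exists_of_iso M X Y := by
    rintro ⟨e⟩
    exact exists_iso_of_retract
      (Retract.trans ⟨biprod.inl, biprod.fst, biprod.inl_fst⟩ (Retract.ofIso e.symm))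

end BoundedSingle

/-! ### Modules over hereditary and Artinian rings -/

section Modules

variable {A : Type u} [Ring A]

/-- Submodules of finitely generated free modules over a hereditary ring are projective. -/
lemma IsHereditary.projective_submodule (hA : IsHereditary A) (n : ℕ)
    (K : Submodule A (Fin n → A)) : Module.Projective A K := by
  induction n with
  | zero =>
    have : Subsingleton K := inferInstance
    infer_instance
  | succ n ih =>
    -- The first coordinate maps `K` onto a left ideal, which is projective, so this map splits; its
    -- kernel embeds in the remaining n coordinates and is projective by induction.
    let f : K →ₗ[A] A := (LinearMap.proj 0).comp K.subtype
    let tl : (Fin (n + 1) → A) →ₗ[A] (Fin n → A) := LinearMap.funLeft A A Fin.succ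
    have : Module.Projective A (LinearMap.range f) := hA _
    obtain ⟨s, hs⟩ := Module.projective_lifting_property f.rangeRestrict LinearMap.id
      f.surjective_rangeRestrict
    let g : LinearMap.ker f →ₗ[A] (Fin n → A) := tl.comp (K.subtype.comp (LinearMap.ker f).subtype)
    have hg : Function.Injective g := by
      rw [injective_iff_map_eq_zero]
      intro x hx
      ext i
      refine Fin.cases ?_ (fun j ↦ ?_) i
      · exact x.2
      · exact congrFun hx j
    have : Module.Projective A (LinearMap.ker f) :=
      have := ih (LinearMap.range g)
      Module.Projective.of_equiv (LinearEquiv.ofInjective g hg).symm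
    let φ : K →ₗ[A] LinearMap.ker f × LinearMap.range f :=
      ((LinearMap.id - s.comp f.rangeRestrict).codRestrict (LinearMap.ker f) fun x ↦ by
        have := congrArg Subtype.val (LinearMap.congr_fun hs (f.rangeRestrict x))
        simp only [LinearMap.comp_apply, LinearMap.codRestrict_apply, LinearMap.rangeRestrict,
          LinearMap.id_apply] at this
        simp [LinearMap.mem_ker, LinearMap.sub_apply, LinearMap.rangeRestrict, this]).prod
        f.rangeRestrict
    refine Module.Projective.of_split (M := LinearMap.ker f × LinearMap.range f) φ
      ((LinearMap.ker f).subtype.coprod s) ?_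
    ext x : 1
    simp [φ]

variable [IsNoetherianRing A]

lemma FGModuleCat.epi_iff_surjective {M N : FGModuleCat.{u} A} (f : M ⟶ N) :
    Epi f ↔ Function.Surjective f.hom.hom := by
  refine ⟨fun h ↦ (ModuleCat.epi_iff_surjective f.hom).1
    (inferInstanceAs (Epi ((forget₂ (FGModuleCat A) (ModuleCat A)).map f))), fun h ↦ ?_⟩
  have : Epi ((forget₂ (FGModuleCat A) (ModuleCat A)).map f) :=
    (ModuleCat.epi_iff_surjective f.hom).2 h
  exact (forget₂ (FGModuleCat A) (ModuleCat A)).epi_of_epi_map this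

lemma FGModuleCat.projective_of_module_projective (M : FGModuleCat.{u} A) [Module.Projective A M] :
    Projective M where
  factors {X Y} f e _ := by
    obtain ⟨g, hg⟩ := Module.projective_lifting_property e.hom.hom f.hom.hom
      ((FGModuleCat.epi_iff_surjective e).1 inferInstance)
    exact ⟨FGModuleCat.ofHom g, FGModuleCat.hom_ext hg⟩

/-- The kernel of a surjection from a finite free module is projective, which gives a projective
resolution of length one. -/
lemma IsHereditary.hasProjectiveDimensionLT (hA : IsHereditary A) (M : FGModuleCat.{u} A) :
    HasProjectiveDimensionLT M 2 := by
  obtain ⟨n, f, hf⟩ := Module.Finite.exists_fin' A M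
  have := hA.projective_submodule n (LinearMap.ker f)
  let S : ShortComplex (FGModuleCat.{u} A) :=
    ShortComplex.mk (X₁ := FGModuleCat.of A (LinearMap.ker f)) (X₂ := FGModuleCat.of A (Fin n → A))
      (X₃ := M) (FGModuleCat.ofHom (LinearMap.ker f).subtype) (FGModuleCat.ofHom f)
      (FGModuleCat.hom_ext (by ext x; exact x.2))
  let F := forget₂ (FGModuleCat.{u} A) (ModuleCat.{u} A)
  have hS : S.ShortExact :=
    { exact := by
        rw [← ShortComplex.exact_map_iff_of_faithful S F, ShortComplex.moduleCat_exact_iff]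
        intro x hx
        exact ⟨⟨x, hx⟩, rfl⟩
      mono_f := by
        have : Mono (F.map S.f) :=
          (ModuleCat.mono_iff_injective S.f.hom).2 (LinearMap.ker f).injective_subtype
        exact F.mono_of_mono_map this
      epi_g := (FGModuleCat.epi_iff_surjective S.g).2 hf }
  have h₁ : Projective S.X₁ :=
    FGModuleCat.projective_of_module_projective (FGModuleCat.of A (LinearMap.ker f))
  have h₂ : Projective S.X₂ :=
    FGModuleCat.projective_of_module_projective (FGModuleCat.of A (Fin n → A))
  exact hS.hasProjectiveDimensionLT_X₃ 1 inferInstance inferInstance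

omit [IsNoetherianRing A] in
lemma FGModuleCat.isZero_iff_subsingleton (M : FGModuleCat.{u} A) : IsZero M ↔ Subsingleton M := by
  rw [IsZero.iff_id_eq_zero]
  refine ⟨fun h ↦ subsingleton_of_forall_eq 0 fun x ↦ ?_, fun h ↦ FGModuleCat.hom_ext ?_⟩
  · exact LinearMap.congr_fun (congrArg (fun f ↦ f.hom.hom) h) x
  · ext x
    exact h.elim _ _

/-- The underlying module of a biproduct is the product. -/
def FGModuleCat.biprodEquiv (M N : FGModuleCat.{u} A) : ↑(M ⊞ N) ≃ₗ[A] M × N where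
  toFun x := ((biprod.fst : M ⊞ N ⟶ M).hom.hom x, (biprod.snd : M ⊞ N ⟶ N).hom.hom x)
  map_add' x y := by simp
  map_smul' r x := by simp
  invFun p := (biprod.inl : M ⟶ M ⊞ N).hom.hom p.1 + (biprod.inr : N ⟶ M ⊞ N).hom.hom p.2
  left_inv x := LinearMap.congr_fun
    (congrArg (fun f : M ⊞ N ⟶ M ⊞ N ↦ f.hom.hom) biprod.total) x
  right_inv p := by
    have h₁ := LinearMap.congr_fun
      (congrArg (fun f : M ⟶ M ↦ f.hom.hom) (biprod.inl_fst (X := M) (Y := N))) p.1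
    have h₂ := LinearMap.congr_fun
      (congrArg (fun f : M ⟶ N ↦ f.hom.hom) (biprod.inl_snd (X := M) (Y := N))) p.1
    have h₃ := LinearMap.congr_fun
      (congrArg (fun f : N ⟶ M ↦ f.hom.hom) (biprod.inr_fst (X := M) (Y := N))) p.2
    have h₄ := LinearMap.congr_fun
      (congrArg (fun f : N ⟶ N ↦ f.hom.hom) (biprod.inr_snd (X := M) (Y := N))) p.2
    refine Prod.ext ((map_add _ _ _).trans ((congrArg₂ _ h₁ h₃).trans (add_zero _)))
      ((map_add _ _ _).trans ((congrArg₂ _ h₂ h₄).trans (zero_add _)))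

/-- Over an Artinian ring, every finitely generated module is a finite direct sum of
indecomposable modules. -/
lemma FGModuleCat.exists_sum_indecomposable [IsArtinianRing A] (M : FGModuleCat.{u} A) :
    ∃ L : List (FGModuleCat.{u} A), (∀ N ∈ L, Indecomposable N) ∧ Nonempty (M ≅ sumList L) := by
  have hfin (N : FGModuleCat.{u} A) : Module.length A N ≠ ⊤ := Module.length_ne_top
  -- Both parts of a nontrivial decomposition have smaller length, since length is finite and
  -- additive and nonzero modules have nonzero length.
  induction hn : (Module.length A M).toNat using Nat.strong_induction_on generalizing M with
  | _ n ih =>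
    by_cases hz : IsZero M
    · exact ⟨[], by simp, ⟨hz.iso (isZero_zero _)⟩⟩
    by_cases hi : Indecomposable M
    · exact ⟨[M], by simpa using hi, ⟨(isoBiprodZero (isZero_zero _))⟩⟩
    simp only [Indecomposable, hz, not_false_eq_true, true_and, not_forall, not_or] at hi
    obtain ⟨X, Y, e, hX, hY⟩ := hi
    have hlen : Module.length A M = Module.length A X + Module.length A Y := by
      rw [← Module.length_prod]
      exact (FGModuleCat.isoToLinearEquiv e ≪≫ₗ FGModuleCat.biprodEquiv X Y).length_eq
    have hpos (N : FGModuleCat.{u} A) (hN : ¬ IsZero N) : (Module.length A N).toNat ≠ 0 := by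
      rw [FGModuleCat.isZero_iff_subsingleton, ← Module.length_eq_zero_iff (R := A)] at hN
      simp [ENat.toNat_eq_zero, hN, hfin N]
    have hlen' : n = (Module.length A X).toNat + (Module.length A Y).toNat := by
      rw [← hn, hlen, ENat.toNat_add (hfin X) (hfin Y)]
    have h₁ := hpos X hX
    have h₂ := hpos Y hY
    obtain ⟨L₁, hL₁, ⟨e₁⟩⟩ := ih _ (by lia) X rfl
    obtain ⟨L₂, hL₂, ⟨e₂⟩⟩ := ih _ (by lia) Y rfl
    obtain ⟨i⟩ := nonempty_sumList_append L₁ L₂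
    refine ⟨L₁ ++ L₂, fun N hN ↦ ?_, ⟨e ≪≫ biprod.mapIso e₁ e₂ ≪≫ i.symm⟩⟩
    rcases List.mem_append.1 hN with hN | hN
    · exact hL₁ N hN
    · exact hL₂ N hN

lemma IsFiniteRepresentationType.exists_sum [IsArtinianRing A]
    (hA : IsFiniteRepresentationType A) :
    ∃ S : Set (FGModuleCat.{u} A), S.Finite ∧ ∀ M : FGModuleCat.{u} A,
      ∃ L : List (FGModuleCat.{u} A), (∀ N ∈ L, N ∈ S ∧ Indecomposable N) ∧
        Nonempty (M ≅ sumList L) := by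
  obtain ⟨S, hS, h⟩ := hA
  refine ⟨S, hS, fun M ↦ ?_⟩
  choose! r hr hri using h
  obtain ⟨L, hL, ⟨e⟩⟩ := FGModuleCat.exists_sum_indecomposable M
  obtain ⟨i⟩ := nonempty_sumList_map L id r fun N hN ↦ hri N (hL N hN)
  rw [List.map_id] at i
  refine ⟨L.map r, fun N hN ↦ ?_, ⟨e ≪≫ i⟩⟩
  obtain ⟨N', hN', rfl⟩ := List.mem_map.1 hN
  exact ⟨hr N' (hL N' hN'), Indecomposable.of_iso (hri N' (hL N' hN')).some (hL N' hN')⟩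

end Modules

/-! ### Thick subcategories generated by orthogonal sums -/

section Thick

variable {T : Type*} [Category* T] [HasZeroObject T] [HasShift T ℤ] [Preadditive T]
  [∀ n : ℤ, (shiftFunctor T n).Additive] [Pretriangulated T]

/-- The objects that are orthogonal on both sides to the objects of `P`. -/
abbrev biorthogonal (P : ObjectProperty T) : ObjectProperty T :=
  P.leftOrthogonal ⊓ P.rightOrthogonal

omit [HasZeroObject T] [HasShift T ℤ] [∀ n : ℤ, (shiftFunctor T n).Additive]
  [Pretriangulated T] in
lemma le_biorthogonal_biorthogonal (P : ObjectProperty T) :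
    P ≤ biorthogonal (biorthogonal P) :=
  fun _ hX ↦ ⟨fun _ f hY ↦ hY.2 f hX, fun _ f hY ↦ hY.1 f hX⟩

lemma exists_iso_biprod_of_extensionProduct {P Q : ObjectProperty T}
    [P.IsStableUnderShift ℤ] (h : ∀ X Y, P X → Q Y → ∀ f : Y ⟶ X, f = 0) {X : T}
    (hX : P.extensionProduct Q X) : ∃ Y Z, P Y ∧ Q Z ∧ Nonempty (X ≅ Y ⊞ Z) := by
  obtain ⟨Y, Z, f, g, m, hT, hY, hZ⟩ := hX
  obtain ⟨e, -⟩ := exists_iso_binaryBiproduct_of_distTriang _ hT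
    (h _ _ (P.le_shift (1 : ℤ) _ hY) hZ m)
  exact ⟨Y, Z, hY, hZ, ⟨e⟩⟩

/-- The connecting morphism goes from `P` to a shift of an object of `Q`, so it vanishes; the
triangle splits and its two ends may be exchanged. -/
lemma extensionProduct_swap_le {P Q : ObjectProperty T} [P.IsStableUnderShift ℤ]
    [Q.IsStableUnderShift ℤ]
    (h : ∀ X Y, P X → Q Y → ∀ f : X ⟶ Y, f = 0) :
    Q.extensionProduct P ≤ P.extensionProduct Q := by
  intro X hX
  obtain ⟨Y, Z, hY, hZ, ⟨e⟩⟩ :=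
    exists_iso_biprod_of_extensionProduct (fun X Y hX hY ↦ h Y X hY hX) hX
  exact (P.extensionProduct Q).prop_of_iso (e ≪≫ biprod.braiding Y Z).symm
    ⟨Z, Y, _, _, _, binaryBiproductTriangle_distinguished Z Y, hZ, hY⟩

/-- With * for extensions, (P * Q) * (P * Q) = P * (Q * P) * Q is contained in P * (P * Q) * Q = (P
* P) * (Q * Q), hence in P * Q. -/
lemma extensionProduct_isTriangulatedClosed₂ [IsTriangulated T] {P Q : ObjectProperty T}
    [P.IsTriangulated] [Q.IsTriangulated] [P.IsClosedUnderIsomorphisms]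
    [Q.IsClosedUnderIsomorphisms] (h : ∀ X Y, P X → Q Y → ∀ f : X ⟶ Y, f = 0) :
    (P.extensionProduct Q).IsTriangulatedClosed₂ := by
  refine .mk' fun S hS h₁ h₃ ↦ ?_
  have hS' : ((P.extensionProduct Q).extensionProduct (P.extensionProduct Q)) S.obj₂ :=
    ⟨_, _, _, _, _, hS, h₁, h₃⟩
  rw [ObjectProperty.extensionProduct_assoc, ← ObjectProperty.extensionProduct_assoc Q P Q] at hS'
  have h₂ : P.extensionProduct ((Q.extensionProduct P).extensionProduct Q) ≤
      P.extensionProduct (P.extensionProduct (Q.extensionProduct Q)) := by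
    rw [← ObjectProperty.extensionProduct_assoc P Q Q]
    exact ObjectProperty.monotone_extensionProduct_right _
      (ObjectProperty.monotone_extensionProduct_left _ (extensionProduct_swap_le h))
  have h₄ := h₂ _ hS'
  rw [← ObjectProperty.extensionProduct_assoc P P] at h₄
  exact ObjectProperty.monotone_extensionProduct_left _
    (ObjectProperty.extensionProduct_le_of_isTriangulatedClosed₂ le_rfl le_rfl) _
    (ObjectProperty.monotone_extensionProduct_right _
      (ObjectProperty.extensionProduct_le_of_isTriangulatedClosed₂ le_rfl le_rfl) _ h₄)

/-- An object of the thick subcategory generated by the sum of two orthogonal objects is a retract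
of the sum of two objects that are orthogonal to each other and to one of the two given objects
each. -/
theorem exists_retract_biprod_of_triangEnvelope [IsTriangulated T] {X X₁ X₂ Z : T}
    (e : X ≅ X₁ ⊞ X₂) (h₁₂ : ∀ (n : ℤ) (f : X₁ ⟶ X₂⟦n⟧), f = 0)
    (h₂₁ : ∀ (n : ℤ) (f : X₂ ⟶ X₁⟦n⟧), f = 0)
    (hZ : (ObjectProperty.singleton X).triangEnvelope Z) :
    ∃ Y₁ Y₂ : T, Nonempty (Retract Z (Y₁ ⊞ Y₂)) ∧ (∀ f : Y₁ ⟶ Y₂, f = 0) ∧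
      (∀ f : Y₂ ⟶ Y₁, f = 0) ∧ (∀ (n : ℤ) (f : Y₁ ⟶ X₂⟦n⟧), f = 0) ∧
      (∀ (n : ℤ) (f : Y₂ ⟶ X₁⟦n⟧), f = 0) := by
  -- Taking two-sided orthogonals twice produces mutually orthogonal triangulated subcategories `P`,
  -- containing X₁, and `Q`, containing X₂.
  let S := (ObjectProperty.singleton X₁).shiftClosure ℤ
  let Q : ObjectProperty T := biorthogonal S
  let P : ObjectProperty T := biorthogonal Q
  have hS (n : ℤ) : S (X₁⟦n⟧) := S.le_shift n _ ((ObjectProperty.le_shiftClosure _) _ (by simp))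
  have hP : P X₁ := le_biorthogonal_biorthogonal S _ ((ObjectProperty.le_shiftClosure _) _ (by simp))
  have hQ : Q X₂ := by
    refine ⟨fun Y f hY ↦ ?_, fun Y f hY ↦ ?_⟩
    · obtain ⟨Y', a, i, hY'⟩ := hY
      obtain rfl : X₁ = Y' := by simpa using hY'
      rw [← cancel_mono i.hom, zero_comp]
      exact h₂₁ a _
    · obtain ⟨Y', a, i, hY'⟩ := hY
      obtain rfl : X₁ = Y' := by simpa using hY'
      rw [← cancel_epi i.inv, ← cancel_mono ((shiftFunctorZero T ℤ).inv.app X₂), comp_zero,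
        zero_comp]
      exact eq_zero_of_shift (c := -a) (by lia) (h₁₂ _) _
  have hPQ : ∀ U V, P U → Q V → ∀ f : U ⟶ V, f = 0 := fun U V hU hV f ↦ hU.1 f hV
  have hQP : ∀ U V, P U → Q V → ∀ f : V ⟶ U, f = 0 := fun U V hU hV f ↦ hU.2 f hV
  have : (P.extensionProduct Q).IsTriangulatedClosed₂ :=
    extensionProduct_isTriangulatedClosed₂ hPQ
  rw [ObjectProperty.prop_triangEnvelope_iff] at hZ
  obtain ⟨n, hn⟩ := hZ
  -- All retracts can be postponed to the end: `Z` is a retract of an iterated extension, and the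
  -- latter lies in the extension-closed `P.extensionProduct Q`.
  rw [ObjectProperty.triangEnvelopeIter,
    ObjectProperty.retractClosure_extensionProductIter_retractClosure] at hn
  obtain ⟨Y, hY, ⟨r⟩⟩ := hn
  have hle : (((ObjectProperty.singleton X).shiftClosure ℤ).binaryProductsClosure) ≤
      P.extensionProduct Q := by
    have : (P.extensionProduct Q).ContainsZero :=
      ⟨0, isZero_zero T, ObjectProperty.le_extensionProduct_left _ _ P.prop_zero⟩
    have : (P.extensionProduct Q).IsTriangulated := ⟨⟩
    rw [ObjectProperty.binaryProductsClosure_le_iff, ObjectProperty.shiftClosure_le_iff]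
    rintro _ ⟨⟩
    exact (P.extensionProduct Q).prop_of_iso e.symm
      ⟨X₁, X₂, _, _, _, binaryBiproductTriangle_distinguished X₁ X₂, hP, hQ⟩
  obtain ⟨Y₁, Y₂, h₁, h₂, ⟨i⟩⟩ := exists_iso_biprod_of_extensionProduct hQP
    (ObjectProperty.extensionProductIter_le_of_isTriangulatedClosed₂ _ hle n _ hY)
  exact ⟨Y₁, Y₂, ⟨r.trans (Retract.ofIso i)⟩, hPQ _ _ h₁ h₂, hQP _ _ h₁ h₂,
    fun n ↦ hPQ _ _ h₁ (Q.le_shift n _ hQ), fun n f ↦ h₂.1 f (hS n)⟩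

end Thick

/-! ### Central idempotents and orthogonal decompositions -/

section ConnectedAlgebra

variable {k : Type u} [Field k] {A : Type u} [Ring A] [Algebra k A]

/-- The central idempotents of a connected algebra are trivial. -/
lemma IsConnectedAlgebra.eq_zero_or_eq_one (hA : IsConnectedAlgebra k A) {c : A}
    (hc : c * c = c) (hcc : ∀ a, a * c = c * a) : c = 0 ∨ c = 1 := by
  have key (d : A) (hd : ∀ a, a * d = d * a) : (Ideal.span {d}).IsTwoSided := ⟨fun {a} b ha ↦ by
    obtain ⟨x, rfl⟩ := Ideal.mem_span_singleton'.1 ha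
    exact Ideal.mem_span_singleton'.2 ⟨x * b, by rw [mul_assoc, mul_assoc, hd]⟩⟩
  have hd (a : A) : a * (1 - c) = (1 - c) * a := by rw [mul_sub, sub_mul, hcc, mul_one, one_mul]
  have hI := key c hcc
  have hJ := key (1 - c) hd
  have h₀ : (1 - c) * c = 0 := by rw [sub_mul, hc, one_mul, sub_self]
  have h₀' : c * (1 - c) = 0 := by rw [mul_sub, hc, mul_one, sub_self]
  -- A central idempotent c decomposes A as A/(c) × A/(1 - c); a zero first factor means c = 1, a
  -- zero second factor c = 0.
  let φ : A →ₐ[k] (A ⧸ Ideal.span {c}) × (A ⧸ Ideal.span {1 - c}) :=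
    (Ideal.Quotient.mkₐ k _).prod (Ideal.Quotient.mkₐ k _)
  have hφ : Function.Bijective φ := by
    constructor
    · rw [injective_iff_map_eq_zero]
      intro a ha
      have h₁ : a ∈ Ideal.span {c} := Ideal.Quotient.eq_zero_iff_mem.1 (congrArg Prod.fst ha)
      have h₂ : a ∈ Ideal.span {1 - c} := Ideal.Quotient.eq_zero_iff_mem.1 (congrArg Prod.snd ha)
      obtain ⟨x, hx⟩ := Ideal.mem_span_singleton'.1 h₁
      obtain ⟨y, hy⟩ := Ideal.mem_span_singleton'.1 h₂
      calc a = x * c * c := by rw [mul_assoc, hc, hx]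
        _ = y * (1 - c) * c := by rw [hx, hy]
        _ = 0 := by rw [mul_assoc, h₀, mul_zero]
    · rintro ⟨x, y⟩
      obtain ⟨a, rfl⟩ := Ideal.Quotient.mk_surjective x
      obtain ⟨b, rfl⟩ := Ideal.Quotient.mk_surjective y
      refine ⟨a * (1 - c) + b * c, Prod.ext ?_ ?_⟩
      · refine Ideal.Quotient.eq.2 (Ideal.mem_span_singleton'.2 ⟨b - a, ?_⟩)
        noncomm_ring
      · refine Ideal.Quotient.eq.2 (Ideal.mem_span_singleton'.2 ⟨a - b, ?_⟩)
        noncomm_ring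
  rcases hA _ _ ⟨AlgEquiv.ofBijective φ hφ⟩ with h | h
  · right
    obtain ⟨x, hx⟩ := Ideal.mem_span_singleton'.1
      (Ideal.Quotient.eq_zero_iff_mem.1 (h.elim (Ideal.Quotient.mk _ (1 : A)) 0))
    calc c = x * c * c := by rw [hx, one_mul]
      _ = 1 := by rw [mul_assoc, hc, hx]
  · left
    obtain ⟨x, hx⟩ := Ideal.mem_span_singleton'.1
      (Ideal.Quotient.eq_zero_iff_mem.1 (h.elim (Ideal.Quotient.mk _ (1 : A)) 0))
    calc c = x * (1 - c) * c := by rw [hx, one_mul]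
      _ = 0 := by rw [mul_assoc, h₀, mul_zero]

end ConnectedAlgebra

section RegularModule

variable {A : Type u} [Ring A]

/-- The endomorphism of the regular module given by right multiplication. -/
def rightMul (a : A) : FGModuleCat.of A A ⟶ FGModuleCat.of A A :=
  FGModuleCat.ofHom (LinearMap.toSpanSingleton A A a)

@[simp] lemma rightMul_apply (a x : A) : (rightMul a).hom.hom x = x * a := rfl

lemma eq_rightMul (f : FGModuleCat.of A A ⟶ FGModuleCat.of A A) :
    f = rightMul (f.hom.hom (1 : A)) := by
  apply FGModuleCat.hom_ext
  apply LinearMap.ext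
  intro (x : A)
  have := f.hom.hom.map_smul x (1 : A)
  rw [smul_eq_mul, mul_one] at this
  exact this

lemma rightMul_comp (a b : A) : rightMul a ≫ rightMul b = rightMul (a * b) :=
  FGModuleCat.hom_ext (LinearMap.ext fun x ↦ mul_assoc x a b)

lemma rightMul_injective : Function.Injective (rightMul (A := A)) := fun a b h ↦ by
  have : (rightMul a).hom.hom (1 : A) = (rightMul b).hom.hom (1 : A) := by rw [h]
  exact (one_mul a).symm.trans (this.trans (one_mul b))

end RegularModule

/-- An object whose endomorphism ring has no nontrivial central idempotents. -/
def HasTrivialCentralIdempotents {C : Type*} [Category* C] [Preadditive C] (X : C) : Prop :=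
  ∀ g : X ⟶ X, g ≫ g = g → (∀ f : X ⟶ X, f ≫ g = g ≫ f) → g = 0 ∨ g = 𝟙 X

/-- Endomorphisms of the regular module are right multiplications, so its central idempotents are
those of the algebra. -/
lemma IsConnectedAlgebra.hasTrivialCentralIdempotents {k : Type u} [Field k] {A : Type u} [Ring A]
    [Algebra k A] (hA : IsConnectedAlgebra k A) :
    HasTrivialCentralIdempotents (FGModuleCat.of A A) := by
  intro g hg hgc
  obtain ⟨c, rfl⟩ : ∃ c, g = rightMul c := ⟨_, eq_rightMul g⟩
  have hc : c * c = c := rightMul_injective (by rw [← rightMul_comp, hg])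
  have hcc (a : A) : a * c = c * a :=
    rightMul_injective (by rw [← rightMul_comp, ← rightMul_comp, hgc])
  rcases hA.eq_zero_or_eq_one hc hcc with rfl | rfl
  · left
    exact FGModuleCat.hom_ext (LinearMap.ext fun x ↦ mul_zero (M₀ := A) x)
  · right
    exact FGModuleCat.hom_ext (LinearMap.ext fun x ↦ mul_one (M := A) x)

lemma HasTrivialCentralIdempotents.map {C D : Type*} [Category* C] [Category* D] [Preadditive C]
    [Preadditive D] (F : C ⥤ D) [F.Additive] [F.Full] [F.Faithful] {X : C}
    (h : HasTrivialCentralIdempotents X) : HasTrivialCentralIdempotents (F.obj X) := by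
  intro g hg hgc
  obtain ⟨g, rfl⟩ := F.map_surjective g
  refine (h g (F.map_injective (by simpa using hg)) fun f ↦ F.map_injective ?_).imp ?_ ?_
  · simpa using hgc (F.map f)
  · rintro rfl
    exact F.map_zero _ _
  · rintro rfl
    exact F.map_id _

section Orthogonal

variable {C : Type*} [Category* C] [Preadditive C] [HasBinaryBiproducts C]

/-- An object without nontrivial central idempotents that is a retract of the sum of two
orthogonal objects is a retract of one of them. -/
lemma HasTrivialCentralIdempotents.nonempty_retract {X Y₁ Y₂ : C}
    (h : HasTrivialCentralIdempotents X) (r : Retract X (Y₁ ⊞ Y₂))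
    (h₁₂ : ∀ f : Y₁ ⟶ Y₂, f = 0) (h₂₁ : ∀ f : Y₂ ⟶ Y₁, f = 0) :
    Nonempty (Retract X Y₁) ∨ Nonempty (Retract X Y₂) := by
  let i₁ := r.i ≫ biprod.fst
  let i₂ := r.i ≫ biprod.snd
  let r₁ := biprod.inl ≫ r.r
  let r₂ := biprod.inr ≫ r.r
  have hsum : i₁ ≫ r₁ + i₂ ≫ r₂ = 𝟙 X := by
    have : r.i ≫ (biprod.fst ≫ biprod.inl + biprod.snd ≫ biprod.inr) ≫ r.r = 𝟙 X := by
      rw [biprod.total]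
      simp
    simpa only [i₁, i₂, r₁, r₂, Preadditive.add_comp, Preadditive.comp_add, Category.assoc]
      using this
  -- These composites factor through morphisms between Y₁ and Y₂. Their vanishing makes `i₁ ≫ r₁`,
  -- whose complement is `i₂ ≫ r₂`, a central idempotent.
  have h₁₂' (f : X ⟶ X) : (i₁ ≫ r₁) ≫ f ≫ (i₂ ≫ r₂) = 0 := by
    have := h₁₂ (r₁ ≫ f ≫ i₂)
    rw [Category.assoc, ← Category.assoc f, ← Category.assoc r₁, this]
    simp
  have h₂₁' (f : X ⟶ X) : (i₂ ≫ r₂) ≫ f ≫ (i₁ ≫ r₁) = 0 := by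
    have := h₂₁ (r₂ ≫ f ≫ i₁)
    rw [Category.assoc, ← Category.assoc f, ← Category.assoc r₂, this]
    simp
  have h₂ : i₂ ≫ r₂ = 𝟙 X - i₁ ≫ r₁ := by rw [← hsum]; abel
  rw [h₂] at h₁₂' h₂₁'
  have hc (f : X ⟶ X) : f ≫ (i₁ ≫ r₁) = (i₁ ≫ r₁) ≫ f := by
    have h₁ := h₁₂' f
    have h₂ := h₂₁' f
    rw [Preadditive.comp_sub, Preadditive.comp_sub, Category.comp_id, sub_eq_zero] at h₁
    rw [Preadditive.sub_comp, Category.id_comp, sub_eq_zero] at h₂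
    exact h₂.trans h₁.symm
  have hi : (i₁ ≫ r₁) ≫ (i₁ ≫ r₁) = i₁ ≫ r₁ := by
    have h₁ := h₁₂' (𝟙 X)
    rw [Category.id_comp, Preadditive.comp_sub, Category.comp_id, sub_eq_zero] at h₁
    exact h₁.symm
  rcases h _ hi hc with h₀ | h₀
  · right
    exact ⟨i₂, r₂, by rw [h₂, h₀, sub_zero]⟩
  · left
    exact ⟨i₁, r₁, h₀⟩

end Orthogonal

/-! ### Detection by the regular module -/

section Detection

variable {C T : Type*} [Category* C] [Category* T] [Preadditive C] [Preadditive T]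
  [HasZeroObject C] [HasZeroObject T] [HasBinaryBiproducts C] [HasBinaryBiproducts T]
  [HasShift T ℤ] [∀ n : ℤ, (shiftFunctor T n).Additive] {E : C ⥤ T} [E.Additive]
  [E.Full] [E.Faithful]

/-- An object `P` such that a morphism vanishes if it vanishes after precomposition with all
morphisms from `P`. -/
def Detects (P : C) : Prop := ∀ (M N : C) (g : M ⟶ N), (∀ f : P ⟶ M, f ≫ g = 0) → g = 0

-- For a summand M[n] of `X`, every morphism P ⟶ M vanishes because its shift composes to zero with
-- the inclusion in `X`; detection then kills the identity of M.
omit [HasZeroObject C] [HasBinaryBiproducts C] [E.Full] in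
lemma IsHereditaryEmbedding.isZero_of_hom_eq_zero (hE : IsHereditaryEmbedding E) {P : C}
    (hP : Detects P) {X : T} (h : ∀ (n : ℤ) (f : E.obj P ⟶ X⟦n⟧), f = 0) : IsZero X := by
  obtain ⟨L, ⟨e⟩⟩ := hE.exists_sum X
  have hL : IsZero (sumList (L.map fun p ↦ (E.obj p.1)⟦p.2⟧)) := by
    refine prop_sumList (fun Y ↦ IsZero Y) (isZero_zero T) (fun Y Z hY hZ ↦ ?_) _ fun Y hY ↦ ?_
    · rw [IsZero.iff_id_eq_zero]
      exact biprod.hom_ext _ _ (hY.eq_of_tgt _ _) (hZ.eq_of_tgt _ _)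
    · obtain ⟨r⟩ := nonempty_retract_sumList hY
      obtain ⟨p, -, rfl⟩ := List.mem_map.1 hY
      have r' := r.trans (Retract.ofIso e.symm)
      have hp : 𝟙 p.1 = 0 := hP _ _ _ fun f ↦ by
        rw [Category.comp_id]
        apply E.map_injective
        apply (shiftFunctor T p.2).map_injective
        have h₁ : (E.map f)⟦p.2⟧' ≫ r'.i = 0 := by
          rw [← cancel_mono ((shiftFunctorZero T ℤ).inv.app X), zero_comp]
          exact eq_zero_of_shift (c := -p.2) (by lia) (h _) _
        have h₂ : (E.map f)⟦p.2⟧' ≫ r'.i ≫ r'.r = 0 := by rw [reassoc_of% h₁, zero_comp]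
        rw [r'.retract, Category.comp_id] at h₂
        rw [h₂, E.map_zero, Functor.map_zero]
      exact (shiftFunctor T p.2).map_isZero (E.map_isZero ((IsZero.iff_id_eq_zero _).2 hp))
  exact hL.of_iso e

omit [HasZeroObject C] [HasBinaryBiproducts C] in
/-- If the thick subcategory generated by `X` contains a detecting object without nontrivial central
idempotents, then `X` does not decompose orthogonally. -/
theorem IsHereditaryEmbedding.isOrthogonallyIndecomposable_of_triangEnvelope [Pretriangulated T]
    [IsTriangulated T] (hE : IsHereditaryEmbedding E) {P : C} (hP : Detects P)
    (hPc : HasTrivialCentralIdempotents P) {X : T}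
    (hX : (ObjectProperty.singleton X).triangEnvelope (E.obj P)) :
    IsOrthogonallyIndecomposable X := by
  rintro X₁ X₂ ⟨e⟩ h₁₂ h₂₁
  obtain ⟨Y₁, Y₂, ⟨r⟩, h₁, h₂, h₃, h₄⟩ := exists_retract_biprod_of_triangEnvelope e h₁₂ h₂₁ hX
  rcases (hPc.map E).nonempty_retract r h₁ h₂ with ⟨⟨s⟩⟩ | ⟨⟨s⟩⟩
  · right
    exact hE.isZero_of_hom_eq_zero hP fun n f ↦ by
      have := h₃ n (s.r ≫ f)
      rw [← Category.id_comp f, ← s.retract, Category.assoc, this, comp_zero]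
  · left
    exact hE.isZero_of_hom_eq_zero hP fun n f ↦ by
      have := h₄ n (s.r ≫ f)
      rw [← Category.id_comp f, ← s.retract, Category.assoc, this, comp_zero]

variable {D : Type*} [Category* D] [Preadditive D] [HasZeroObject D] [HasShift D ℤ]
  {R : Type*} [Ring R] [Linear R D] [∀ n : ℤ, (shiftFunctor D n).Additive]
  [∀ n : ℤ, (shiftFunctor D n).Linear R] (G : T ⥤ D) [G.Additive] [G.Full] [G.Faithful]
  [G.CommShift ℤ]

omit [HasZeroObject C] [HasBinaryBiproducts C] [HasZeroObject D] in
/-- A scalar that acts as zero on a detecting object acts as zero everywhere. -/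
lemma IsHereditaryEmbedding.smul_id_eq_zero (hE : IsHereditaryEmbedding E) {P : C}
    (hP : Detects P) {z : R} (h : z • 𝟙 (G.obj (E.obj P)) = 0) (X : T) :
    z • 𝟙 (G.obj X) = 0 := by
  have hiso {Y Z : D} (e : Y ≅ Z) (hY : z • 𝟙 Y = 0) : z • 𝟙 Z = 0 := by
    have : e.inv ≫ (z • 𝟙 Y) ≫ e.hom = z • 𝟙 Z := by simp
    rw [← this, hY, zero_comp, comp_zero]
  have hcomp {Y Z : D} (f : Y ⟶ Z) (hY : z • 𝟙 Y = 0) : z • f = 0 := by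
    have : (z • 𝟙 Y) ≫ f = z • f := by simp
    rw [← this, hY, zero_comp]
  obtain ⟨L, ⟨e⟩⟩ := hE.exists_sum X
  refine hiso (G.mapIso e.symm) ?_
  refine prop_sumList (fun Y ↦ z • 𝟙 (G.obj Y) = 0) ?_ (fun Y Z hY hZ ↦ ?_) _ fun Y hY ↦ ?_
  · exact (G.map_isZero (isZero_zero T)).eq_of_src _ _
  · have : 𝟙 (G.obj (Y ⊞ Z)) = G.map biprod.fst ≫ G.map biprod.inl +
        G.map biprod.snd ≫ G.map biprod.inr := by
      rw [← G.map_comp, ← G.map_comp, ← G.map_add, biprod.total, G.map_id]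
    rw [this, smul_add, ← Linear.comp_smul, ← Linear.comp_smul, hcomp _ hY, hcomp _ hZ, comp_zero,
      comp_zero, add_zero]
  · obtain ⟨p, -, rfl⟩ := List.mem_map.1 hY
    -- By full faithfulness the scalar acts on M[n] through an endomorphism g'' of M. Composed with
    -- any P ⟶ M it is zero, since the scalar already kills P[n].
    obtain ⟨g, hg⟩ := G.map_surjective (z • 𝟙 (G.obj ((E.obj p.1)⟦p.2⟧)))
    obtain ⟨g', hg'⟩ := (shiftFunctor T p.2).map_surjective g
    obtain ⟨g'', rfl⟩ := E.map_surjective g'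
    have hs : z • 𝟙 (G.obj ((E.obj P)⟦p.2⟧)) = 0 := by
      refine hiso ((G.commShiftIso p.2).app (E.obj P)).symm ?_
      have : (shiftFunctor D p.2).map (z • 𝟙 (G.obj (E.obj P))) =
          z • 𝟙 ((G.obj (E.obj P))⟦p.2⟧) := by
        rw [Functor.map_smul, CategoryTheory.Functor.map_id]
      exact this.symm.trans (by rw [h, Functor.map_zero])
    have h₀ : g'' = 0 := hP _ _ _ fun f ↦ by
      apply E.map_injective
      apply (shiftFunctor T p.2).map_injective
      apply G.map_injective
      rw [E.map_comp, Functor.map_comp, hg', G.map_comp, hg, Linear.comp_smul, hcomp _ hs]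
      simp
    rw [← hg, ← hg', h₀]
    simp

omit [HasZeroObject C] [HasBinaryBiproducts C] [HasZeroObject D] in
/-- A scalar that is idempotent on a detecting object without nontrivial central idempotents acts
as zero everywhere or as one everywhere. -/
lemma IsHereditaryEmbedding.smul_id_eq_zero_or (hE : IsHereditaryEmbedding E) {P : C}
    (hP : Detects P) (hPc : HasTrivialCentralIdempotents P) {z : R} (hz : z * z = z) :
    (∀ X : T, z • 𝟙 (G.obj X) = 0) ∨ (∀ X : T, z • 𝟙 (G.obj X) = 𝟙 (G.obj X)) := by
  rcases (hPc.map (E ⋙ G)) (z • 𝟙 _) (by simp [smul_smul, hz]) (by simp) with h | h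
  · exact Or.inl (hE.smul_id_eq_zero G hP h)
  · refine Or.inr fun X ↦ ?_
    -- A scalar acting as one on `P` has complement 1 - z acting as zero there.
    have := hE.smul_id_eq_zero G hP (z := 1 - z)
      (by rw [sub_smul, one_smul]; exact sub_eq_zero.2 h.symm) X
    rw [sub_smul, one_smul, sub_eq_zero] at this
    exact this.symm

end Detection

lemma detects_regular {A : Type u} [Ring A] : Detects (FGModuleCat.of A A) := by
  intro M N g h
  apply FGModuleCat.hom_ext
  ext x
  have := LinearMap.congr_fun (congrArg (fun f ↦ f.hom.hom)
    (h (FGModuleCat.ofHom (LinearMap.toSpanSingleton A M x)))) (1 : A)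
  exact (congrArg g.hom.hom (one_smul A x).symm).trans this

/-! ### Endomorphism algebras and the action of the centre -/

section EndomorphismAlgebras

variable (k : Type*) [Field k] {C D : Type*} [Category* C] [Category* D] [Preadditive C]
  [Preadditive D] [Linear k C] [Linear k D]

/-- A fully faithful linear functor preserves endomorphism algebras. -/
def endAlgEquiv (F : C ⥤ D) [F.Additive] [F.Linear k] [F.Full] [F.Faithful] (X : C) :
    End X ≃ₐ[k] End (F.obj X) :=
  AlgEquiv.ofLinearEquiv
    (LinearEquiv.ofBijective (F.mapLinearMap k) ⟨F.map_injective, F.map_surjective⟩)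
    (F.map_id X) fun f g ↦ F.map_comp g f

/-- Isomorphic objects have isomorphic endomorphism algebras. -/
def conjAlgEquiv {X Y : C} (e : X ≅ Y) : End X ≃ₐ[k] End Y :=
  AlgEquiv.ofLinearEquiv
    { toFun := fun f ↦ e.inv ≫ f ≫ e.hom
      invFun := fun f ↦ e.hom ≫ f ≫ e.inv
      map_add' := fun (f g : X ⟶ X) ↦ by
        rw [Preadditive.add_comp, Preadditive.comp_add]
      map_smul' := fun r (f : X ⟶ X) ↦ by
        rw [Linear.smul_comp, Linear.comp_smul, RingHom.id_apply]
      left_inv := fun f ↦ by simp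
      right_inv := fun f ↦ by simp }
    (by simp [End.one_def]) fun f g ↦ by simp [End.mul_def]

end EndomorphismAlgebras

/-- The endomorphism algebra of the regular left module is the opposite algebra. -/
def regularEndAlgEquiv (k : Type u) [Field k] (B : Type u) [Ring B] [Algebra k B] :
    Bᵐᵒᵖ ≃ₐ[k] End (FGModuleCat.of B B) :=
  AlgEquiv.ofLinearEquiv
    (LinearEquiv.ofBijective
      { toFun := fun b ↦ rightMul b.unop
        map_add' := fun a b ↦ FGModuleCat.hom_ext (LinearMap.ext fun x ↦
          mul_add (x : B) a.unop b.unop)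
        map_smul' := fun r b ↦ FGModuleCat.hom_ext (LinearMap.ext fun x ↦ by
          change (x : B) * (r • b.unop) = algebraMap k B r * ((x : B) * b.unop)
          rw [mul_smul_comm, Algebra.smul_def]) }
      ⟨fun a b h ↦ MulOpposite.unop_injective (rightMul_injective h),
        fun f ↦ ⟨MulOpposite.op (f.hom.hom (1 : B)), (eq_rightMul f).symm⟩⟩)
    (FGModuleCat.hom_ext (LinearMap.ext fun x ↦ mul_one (x : B)))
    fun a b ↦ (rightMul_comp b.unop a.unop).symm

section Orthogonal

variable {C : Type*} [Category* C] [Preadditive C] [HasBinaryBiproducts C] [HasShift C ℤ]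

/-- `X` is a retract of one of the two orthogonal summands, so the other summand is a retract of an
object orthogonal to it and vanishes. -/
lemma HasTrivialCentralIdempotents.isOrthogonallyIndecomposable {X : C}
    (h : HasTrivialCentralIdempotents X) : IsOrthogonallyIndecomposable X := by
  rintro X₁ X₂ ⟨e⟩ h₁₂ h₂₁
  have hz {Y Z : C} (h : ∀ (n : ℤ) (f : Y ⟶ Z⟦n⟧), f = 0) (f : Y ⟶ Z) : f = 0 := by
    rw [← cancel_mono ((shiftFunctorZero C ℤ).inv.app Z), zero_comp]
    exact h 0 _
  have r₁ : Retract X₁ X :=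
    Retract.trans ⟨biprod.inl, biprod.fst, biprod.inl_fst⟩ (Retract.ofIso e.symm)
  have r₂ : Retract X₂ X :=
    Retract.trans ⟨biprod.inr, biprod.snd, biprod.inr_snd⟩ (Retract.ofIso e.symm)
  rcases h.nonempty_retract (Retract.ofIso e) (hz h₁₂) (hz h₂₁) with ⟨⟨s⟩⟩ | ⟨⟨s⟩⟩
  · right
    have s' := r₂.trans s
    rw [IsZero.iff_id_eq_zero, ← s'.retract, hz h₂₁ s'.i, zero_comp]
  · left
    have s' := r₁.trans s
    rw [IsZero.iff_id_eq_zero, ← s'.retract, hz h₁₂ s'.i, zero_comp]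

end Orthogonal

section Center

variable {B : Type u} [Ring B] {c : B}

/-- The action of a central element on all modules. -/
def centralAction (hc : ∀ a, a * c = c * a) : CatCenter (FGModuleCat.{u} B) where
  app M := FGModuleCat.ofHom
    { toFun := fun x : M ↦ c • x
      map_add' := smul_add c
      map_smul' := fun a x ↦ by
        rw [RingHom.id_apply, smul_smul, smul_smul, hc] }
  naturality M N f := FGModuleCat.hom_ext (LinearMap.ext fun x ↦ f.hom.hom.map_smul c x |>.symm)

lemma centralAction_mul_self (hc : ∀ a, a * c = c * a) (hcc : c * c = c) :
    centralAction hc * centralAction hc = centralAction hc := by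
  apply NatTrans.ext
  funext M
  refine FGModuleCat.hom_ext (LinearMap.ext fun x ↦ ?_)
  change c • c • (x : M) = c • x
  rw [smul_smul, hcc]

lemma centralAction_regular (hc : ∀ a, a * c = c * a) :
    (centralAction hc).app (FGModuleCat.of B B) = rightMul c :=
  FGModuleCat.hom_ext (LinearMap.ext fun x ↦ (hc x).symm)

end Center

section DerivedEquivalence

variable {T : Type*} [Category* T] [Preadditive T] [HasZeroObject T] [HasBinaryBiproducts T]
  [HasShift T ℤ] [∀ n : ℤ, (shiftFunctor T n).Additive]
  {C : Type*} [Category* C] [Preadditive C] {E : C ⥤ T} [E.Additive] [E.Full] [E.Faithful]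
  {B : Type u} [Ring B] [IsNoetherianRing B]
  (F : T ⥤ BoundedDerivedCategory B) [F.CommShift ℤ] [F.Additive] [F.Full] [F.Faithful]

omit [Preadditive T] [HasZeroObject T] [HasBinaryBiproducts T] [HasShift T ℤ]
  [∀ n : ℤ, (shiftFunctor T n).Additive] [F.CommShift ℤ] [F.Additive] [F.Full] [F.Faithful] in
lemma map_eq_smul_id {R : Type*} [Ring R] [Linear R (FGModuleCat.{u} B)] {z : R} {c : B}
    (h : z • 𝟙 (FGModuleCat.of B B) = rightMul c) {X : T} {p : X ⟶ X}
    (e : F.obj X ≅ (boundedSingle (FGModuleCat.{u} B)).obj (FGModuleCat.of B B))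
    (hp : (boundedSingle (FGModuleCat.{u} B)).map (rightMul c) = e.inv ≫ F.map p ≫ e.hom) :
    (F ⋙ Bounded.ι).map p = z • 𝟙 ((F ⋙ Bounded.ι).obj X) := by
  have h₁ : F.map p = z • 𝟙 (F.obj X) := by
    have h₂ : F.map p = e.hom ≫ (boundedSingle (FGModuleCat.{u} B)).map (rightMul c) ≫ e.inv := by
      simp [hp]
    rw [h₂, ← h, Functor.map_smul, CategoryTheory.Functor.map_id, Linear.smul_comp,
      Category.id_comp, Linear.comp_smul, e.hom_inv_id]
  exact (congrArg (Bounded.ι.map ·) h₁).trans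
    ((Bounded.ι.map_smul z (𝟙 (F.obj X))).trans (by rw [CategoryTheory.Functor.map_id]; rfl))

/-- If the bounded derived category of a ring `B` is equivalent to a category in which some
detecting object has no nontrivial central idempotents, then `B` has no nontrivial central
idempotents. -/
theorem IsHereditaryEmbedding.hasTrivialCentralIdempotents [HasZeroObject C]
    [HasBinaryBiproducts C] (hE : IsHereditaryEmbedding E) {P : C} (hP : Detects P)
    (hPc : HasTrivialCentralIdempotents P) {X : T}
    (e : F.obj X ≅ (boundedSingle (FGModuleCat.{u} B)).obj (FGModuleCat.of B B)) :
    HasTrivialCentralIdempotents X := by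
  intro p hp hpc
  obtain ⟨q, hq⟩ := (boundedSingle (FGModuleCat.{u} B)).map_surjective
    (e.inv ≫ F.map p ≫ e.hom)
  obtain ⟨c, rfl⟩ : ∃ c, q = rightMul c := ⟨_, eq_rightMul q⟩
  have hcc : c * c = c := rightMul_injective (by
    rw [← rightMul_comp]
    apply (boundedSingle (FGModuleCat.{u} B)).map_injective
    rw [Functor.map_comp, hq]
    simp only [Category.assoc, Iso.hom_inv_id_assoc]
    rw [← F.map_comp_assoc, hp])
  have hc (a : B) : a * c = c * a := rightMul_injective (by
    rw [← rightMul_comp, ← rightMul_comp]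
    apply (boundedSingle (FGModuleCat.{u} B)).map_injective
    obtain ⟨f, hf⟩ := F.map_surjective
      (e.hom ≫ (boundedSingle (FGModuleCat.{u} B)).map (rightMul a) ≫ e.inv)
    have hf' : (boundedSingle (FGModuleCat.{u} B)).map (rightMul a) = e.inv ≫ F.map f ≫ e.hom := by
      simp [hf]
    rw [Functor.map_comp, Functor.map_comp, hq, hf']
    simp only [Category.assoc, Iso.hom_inv_id_assoc]
    rw [← F.map_comp_assoc, ← F.map_comp_assoc, hpc])
  -- The derived category becomes linear over the centre of the module category. Thus p, given by
  -- the central idempotent c of `B`, is the action of a scalar defined on all objects, including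
  -- the image of `P`.
  let L : Linear (CatCenter (FGModuleCat.{u} B)) (FGModuleCat.{u} B) :=
    Linear.ofRingMorphism (RingHom.id _)
  have key := map_eq_smul_id F (z := centralAction hc)
    ((Category.comp_id _).trans (centralAction_regular hc)) e hq
  rcases hE.smul_id_eq_zero_or (F ⋙ Bounded.ι) hP hPc (centralAction_mul_self hc hcc) with h | h
  · left
    apply (F ⋙ Bounded.ι).map_injective
    rw [key, h, Functor.map_zero]
  · right
    apply (F ⋙ Bounded.ι).map_injective
    rw [key, h, CategoryTheory.Functor.map_id]

end DerivedEquivalence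

/-! ### Properties of the regular module, and the main theorem -/

section Basic

variable {C : Type u} [Category.{v} C] [Abelian C] [HasDerivedCategory.{w} C]

/-- All summands of a module in degree zero are again modules in degree zero, so decompositions
descend to `C`. -/
lemma IsBasicObject.boundedSingle {M : C} (h : IsBasicObject M) :
    IsBasicObject ((boundedSingle C).obj M) := by
  rintro X Y Z hX hY ⟨e⟩
  have := preservesBinaryBiproducts_of_preservesBiproducts (DerivedFinite.boundedSingle C)
  have rXY : Retract (X ⊞ Y) ((DerivedFinite.boundedSingle C).obj M) :=
    Retract.trans ⟨biprod.inl, biprod.fst, biprod.inl_fst⟩ (Retract.ofIso e.symm)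
  have rZ : Retract Z ((DerivedFinite.boundedSingle C).obj M) :=
    Retract.trans ⟨biprod.inr, biprod.snd, biprod.inr_snd⟩ (Retract.ofIso e.symm)
  obtain ⟨M₁, ⟨e₁⟩⟩ := exists_iso_of_retract
    (Retract.trans ⟨biprod.inl, biprod.fst, biprod.inl_fst⟩ rXY)
  obtain ⟨M₂, ⟨e₂⟩⟩ := exists_iso_of_retract
    (Retract.trans ⟨biprod.inr, biprod.snd, biprod.inr_snd⟩ rXY)
  obtain ⟨M₃, ⟨e₃⟩⟩ := exists_iso_of_retract rZ
  have hind (N : C) (X : Bounded C) (e : X ≅ (DerivedFinite.boundedSingle C).obj N)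
      (hX : Indecomposable X) : Indecomposable N := by
    have hz (N : C) (hN : IsZero ((DerivedFinite.boundedSingle C).obj N)) : IsZero N := by
      rw [IsZero.iff_id_eq_zero] at hN ⊢
      exact (DerivedFinite.boundedSingle C).map_injective
        (by rw [CategoryTheory.Functor.map_id, hN, Functor.map_zero])
    refine ⟨fun hN ↦ hX.1 (((DerivedFinite.boundedSingle C).map_isZero hN).of_iso e),
      fun U V i ↦ ?_⟩
    exact (hX.2 _ _ (e ≪≫ (DerivedFinite.boundedSingle C).mapIso i ≪≫
      (DerivedFinite.boundedSingle C).mapBiprod _ _)).imp (hz U) (hz V)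
  have i : M ≅ (M₁ ⊞ M₂) ⊞ M₃ := (DerivedFinite.boundedSingle C).preimageIso
    (e ≪≫ biprod.mapIso (biprod.mapIso e₁ e₂ ≪≫
      ((DerivedFinite.boundedSingle C).mapBiprod _ _).symm) e₃ ≪≫
        ((DerivedFinite.boundedSingle C).mapBiprod _ _).symm)
  have := h M₁ M₂ M₃ (hind _ _ e₁ hX) (hind _ _ e₂ hY) ⟨i⟩
  exact ⟨fun j ↦ this.false ((DerivedFinite.boundedSingle C).preimageIso (e₁.symm ≪≫ j ≪≫ e₂))⟩

end Basic

lemma IsExceptional.of_map {T T' : Type*} [Category* T] [Category* T'] [Preadditive T]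
    [Preadditive T'] [HasShift T ℤ] [HasShift T' ℤ] (F : T ⥤ T') [F.CommShift ℤ] [F.Additive]
    [F.Faithful] {X : T} (h : IsExceptional (F.obj X)) : IsExceptional X := by
  intro n hn f
  apply F.map_injective
  rw [← cancel_mono ((F.commShiftIso n).hom.app X), F.map_zero, zero_comp]
  exact h n hn _

lemma isExceptional_boundedSingle_regular (B : Type u) [Ring B] [IsNoetherianRing B] :
    IsExceptional ((boundedSingle (FGModuleCat.{u} B)).obj (FGModuleCat.of B B)) := by
  intro n hn f
  have : Projective (FGModuleCat.of B B) :=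
    FGModuleCat.projective_of_module_projective (FGModuleCat.of B B)
  exact boundedSingle_hom_shift_eq_zero _ _ 1 n (by lia) f

section Main

variable {k : Type u} [Field k] {A : Type u} [Ring A] [Algebra k A] [IsNoetherianRing A]

lemma isPerfect_regular : IsPerfect ((boundedSingle (FGModuleCat.{u} A)).obj
    (FGModuleCat.of A A)) := by
  refine ⟨(CochainComplex.singleFunctor _ 0).obj (FGModuleCat.of A A), 0, 0, inferInstance,
    inferInstance, fun i ↦ ?_, 
    ⟨(singleFunctorIsoCompQ (FGModuleCat.{u} A) 0).app (FGModuleCat.of A A)⟩⟩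
  by_cases hi : i = 0
  · subst hi
    exact Module.Projective.of_equiv (FGModuleCat.isoToLinearEquiv
      (HomologicalComplex.singleObjXSelf (ComplexShape.up ℤ) 0 (FGModuleCat.of A A)).symm)
  · have : Subsingleton (((CochainComplex.singleFunctor (FGModuleCat.{u} A) 0).obj
      (FGModuleCat.of A A)).X i) := (FGModuleCat.isZero_iff_subsingleton _).1
      (HomologicalComplex.isZero_single_obj_X (ComplexShape.up ℤ) 0 (FGModuleCat.of A A) i hi)
    infer_instance

/-- Over a connected hereditary algebra, tilting complexes do not decompose orthogonally. -/
lemma IsTiltingComplex.isOrthogonallyIndecomposable (hA : IsConnectedAlgebra k A)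
    (hA' : IsHereditary A) {T : BoundedDerivedCategory A} (hT : IsTiltingComplex T) :
    IsOrthogonallyIndecomposable T :=
  (isHereditaryEmbedding_boundedSingle
    hA'.hasProjectiveDimensionLT).isOrthogonallyIndecomposable_of_triangEnvelope
      detects_regular hA.hasTrivialCentralIdempotents (by rw [hT.generates]; exact isPerfect_regular)

variable (k) in
/-- Shifts have isomorphic endomorphism algebras. -/
def endShiftAlgEquiv (X : BoundedDerivedCategory A) (n : ℤ) :
    End (Bounded.ι.obj X) ≃ₐ[k] End (X⟦n⟧) :=
  (endAlgEquiv k (shiftFunctor (DerivedCategory (FGModuleCat.{u} A)) n) (Bounded.ι.obj X)).trans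
    ((conjAlgEquiv k ((Bounded.ι.commShiftIso n).symm.app X)).trans
      (endAlgEquiv k Bounded.ι (X⟦n⟧)).symm)

/-- A basic ring that is derived equivalent to a connected hereditary algebra is given by a basic
exceptional object. -/
lemma exists_of_derivedEquivalent (hA : IsConnectedAlgebra k A) (hA' : IsHereditary A)
    {B : Type u} [Ring B] [Algebra k B] [IsNoetherianRing B] (hB : IsBasicRing B)
    (h : DerivedEquivalent k A B) :
    ∃ T : BoundedDerivedCategory A, IsExceptional T ∧ IsBasicObject T ∧
      IsOrthogonallyIndecomposable T ∧ Nonempty (End T ≃ₐ[k] Bᵐᵒᵖ) := by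
  obtain ⟨F, _, _, _, _⟩ := h
  let Y := (boundedSingle (FGModuleCat.{u} B)).obj (FGModuleCat.of B B)
  let e : F.obj (F.objPreimage Y) ≅ Y := F.objObjPreimageIso Y
  have he : IsExceptional (F.obj (F.objPreimage Y)) := fun n hn f ↦
    (isExceptional_boundedSingle_regular B).eq_zero_of_retract (Retract.ofIso e) (Retract.ofIso e)
      hn f
  refine ⟨F.objPreimage Y, he.of_map F, IsBasicObject.of_map F (hB.boundedSingle.of_iso e.symm),
    ?_, ?_⟩
  · exact ((isHereditaryEmbedding_boundedSingle
      hA'.hasProjectiveDimensionLT).hasTrivialCentralIdempotents F detects_regular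
        hA.hasTrivialCentralIdempotents e).isOrthogonallyIndecomposable
  · exact ⟨(endAlgEquiv k F _).trans ((conjAlgEquiv k e).trans
      ((endAlgEquiv k (boundedSingle (FGModuleCat.{u} B)) (FGModuleCat.of B B)).symm.trans
        (regularEndAlgEquiv k B).symm))⟩

end Main

end DerivedFinite

end

open DerivedFinite in
theorem proposition5p2 (k : Type u) [Field k] [IsAlgClosed k]
    (A : Type u) [Ring A] [Algebra k A] [Module.Finite k A] :
    haveI : IsNoetherianRing A := IsNoetherianRing.of_finite k A
    IsConnectedAlgebra k A → IsHereditary A → IsFiniteRepresentationType A →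
      (∃ S : Set (BoundedDerivedCategory A), S.Finite ∧
        ∀ T : BoundedDerivedCategory A, IsTiltingComplex T → IsBasicObject T →
          ∃ X ∈ S, ∃ n : ℤ, Nonempty (T ≅ X⟦n⟧)) ∧
      (∃ S : Set (AlgCat.{u} k), S.Finite ∧
        ∀ (B : Type u) [Ring B] [Algebra k B] [Module.Finite k B],
          haveI : IsNoetherianRing B := IsNoetherianRing.of_finite k B
          IsBasicRing B → DerivedEquivalent k A B → ∃ Γ ∈ S, Nonempty (B ≃ₐ[k] Γ)) := by
  have : IsNoetherianRing A := IsNoetherianRing.of_finite k A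
  have : IsArtinianRing A := IsArtinianRing.of_finite k A
  intro hA hA' hA''
  obtain ⟨S₀, hS₀, hS₀'⟩ := hA''.exists_sum
  obtain ⟨S, hS, hS'⟩ := (isHereditaryEmbedding_boundedSingle
    hA'.hasProjectiveDimensionLT).exists_finite hS₀ hS₀'
  refine ⟨⟨S, hS, fun T hT hb ↦ hS' T hT.exceptional hb
    (hT.isOrthogonallyIndecomposable hA hA')⟩, ?_⟩
  classical
  -- Endomorphism algebras in the derived category live in a larger universe, so an algebra in `Type
  -- u` with the right opposite is chosen; `A` is a default value when there is none.
  let Γ (X : BoundedDerivedCategory A) : AlgCat.{u} k :=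
    if h : ∃ Γ : AlgCat.{u} k, Nonempty (End (DerivedCategory.Bounded.ι.obj X) ≃ₐ[k] Γᵐᵒᵖ)
    then h.choose else AlgCat.of k A
  refine ⟨Γ '' S, hS.image Γ, fun B _ _ _ ↦ ?_⟩
  have : IsNoetherianRing B := IsNoetherianRing.of_finite k B
  intro hB h
  obtain ⟨T, hT, hb, ho, ⟨e⟩⟩ := exists_of_derivedEquivalent hA hA' hB h
  obtain ⟨X, hX, n, ⟨i⟩⟩ := hS' T hT hb ho
  let e' : End (DerivedCategory.Bounded.ι.obj X) ≃ₐ[k] Bᵐᵒᵖ :=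
    (endShiftAlgEquiv k X n).trans ((conjAlgEquiv k i.symm).trans e)
  have hΓ : ∃ Γ : AlgCat.{u} k,
      Nonempty (End (DerivedCategory.Bounded.ι.obj X) ≃ₐ[k] Γᵐᵒᵖ) := ⟨AlgCat.of k B, ⟨e'⟩⟩
  refine ⟨Γ X, ⟨X, hX, rfl⟩, ?_⟩
  rw [show Γ X = hΓ.choose from dif_pos hΓ]
  obtain ⟨e''⟩ := hΓ.choose_spec
  exact ⟨AlgEquiv.unop (e'.symm.trans e'')⟩
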